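/- Let $p$ be a prime, let $F$ be a field of characteristic different from $p$ containing a primitive $p$th root of unity $\xi_p$, let $a\in F^\times$ not be a $p$th power in $F$, and let $K=F(\sqrt[p]{a})$, a cyclic extension of degree $p$ with group $G=\mathrm{Gal}(K/F)$. Let $J=K^\times/K^{\times p}$, regarded as an $\mathbb{F}_p[G]$-module, and let $N\colon K^\times\to F^\times$ be the norm map of $K/F$. For $b\in F^\times$ write $[b]$ for its class in $F^\times/F^{\times p}$, and let $\left(\frac{a,b}{F,\xi_p}\right)$ be the cyclic algebra generated over $F$ by $x,y$ with $x^p=a$, $y^p=b$, $yx=\xi_p xy$. For $p>2$, $a$ is called $p$-rigid if $[b]\in\langle[a]\rangle$ for every $b\in F^\times$ for which $\left(\frac{a,b}{F,\xi_p}\right)$ has trivial class in the Brauer group $\mathrm{Br}(F)$. A free direct summand means a nonzero one, and $J$ is called $G$-invariant if $J^G=J$. Then: (1) $J$ is a free $\mathbb{F}_p[G]$-module if and only if $p=2$, $-1\notin N(K^\times)$ and $F^\times=N(K^\times)\cup -N(K^\times)$. (2) If $p>2$, then $J$ contains no free direct summand if and only if $a$ is $p$-rigid. If $p=2$, then $J$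 contains no free direct summand if and only if $N(K^\times)/F^{\times 2}\subseteq\langle[a]\rangle$ in $F^\times/F^{\times 2}$; and in this case $\sqrt{-1}\in K^\times$. (3) If $p>2$, then $J$ is $G$-invariant if and only if $a$ is $p$-rigid and $K^\times$ contains a primitive $p^2$th root of unity $\xi_{p^2}$. If $p=2$, then $J$ is $G$-invariant if and only if $J$ contains no free direct summand. -/

import Mathlib

universe u v

open scoped Pointwise

/-! ## Cyclic (symbol) algebras and their Brauer classes -/

section CyclicAlgebra

variable {F : Type u} [Field F]

/-- Defining relations of the cyclic algebra on the generators `x = ι 0`, `y = ι 1`: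
`x ^ n = a`, `y ^ n = b`, `y x = ξ x y`. -/
inductive CyclicAlgebra.Rel (n : ℕ) (ξ a b : F) :
    FreeAlgebra F (Fin 2) → FreeAlgebra F (Fin 2) → Prop
  | x_pow : CyclicAlgebra.Rel n ξ a b (FreeAlgebra.ι F 0 ^ n) (algebraMap F _ a)
  | y_pow : CyclicAlgebra.Rel n ξ a b (FreeAlgebra.ι F 1 ^ n) (algebraMap F _ b)
  | comm : CyclicAlgebra.Rel n ξ a b (FreeAlgebra.ι F 1 * FreeAlgebra.ι F 0)
      (ξ • (FreeAlgebra.ι F 0 * FreeAlgebra.ι F 1))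

/-- The cyclic algebra `(a, b / F, ξ)` of degree `n`: the `F`-algebra generated by `x, y` subject
to `x ^ n = a`, `y ^ n = b`, `y x = ξ x y`. -/
abbrev CyclicAlgebra (n : ℕ) (ξ a b : F) : Type u :=
  RingQuot (CyclicAlgebra.Rel n ξ a b)

namespace CyclicAlgebra

/-- The generator `x`. -/
noncomputable def x (n : ℕ) (ξ a b : F) : CyclicAlgebra n ξ a b :=
  RingQuot.mkAlgHom F (Rel n ξ a b) (FreeAlgebra.ι F 0)

/-- The generator `y`. -/
noncomputable def y (n : ℕ) (ξ a b : F) : CyclicAlgebra n ξ a b :=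
  RingQuot.mkAlgHom F (Rel n ξ a b) (FreeAlgebra.ι F 1)

section facts

variable (n : ℕ) (ξ a b : F)

theorem x_pow_n : x n ξ a b ^ n = algebraMap F _ a := by
  have := RingQuot.mkAlgHom_rel F (Rel.x_pow (n := n) (ξ := ξ) (a := a) (b := b))
  simpa [x] using this

theorem y_pow_n : y n ξ a b ^ n = algebraMap F _ b := by
  have := RingQuot.mkAlgHom_rel F (Rel.y_pow (n := n) (ξ := ξ) (a := a) (b := b))
  simpa [y] using this

theorem y_mul_x : y n ξ a b * x n ξ a b = ξ • (x n ξ a b * y n ξ a b) := by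
  have := RingQuot.mkAlgHom_rel F (Rel.comm (n := n) (ξ := ξ) (a := a) (b := b))
  simpa [x, y] using this

theorem y_pow_mul_x (l : ℕ) :
    y n ξ a b ^ l * x n ξ a b = ξ ^ l • (x n ξ a b * y n ξ a b ^ l) := by
  induction l with
  | zero => simp
  | succ l ih =>
    rw [pow_succ', mul_assoc, ih, mul_smul_comm, ← mul_assoc, y_mul_x, smul_mul_assoc, smul_smul,
      mul_assoc, pow_succ]

theorem y_pow_mul_x_pow (l k : ℕ) :
    y n ξ a b ^ l * x n ξ a b ^ k = ξ ^ (l * k) • (x n ξ a b ^ k * y n ξ a b ^ l) := by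
  induction k with
  | zero => simp
  | succ k ih =>
    rw [pow_succ, ← mul_assoc, ih, smul_mul_assoc, mul_assoc, y_pow_mul_x, mul_smul_comm, smul_smul,
      ← mul_assoc, Nat.mul_succ, pow_add]

/-- The monomial `x ^ i * y ^ j`. -/
noncomputable def mon (i j : ℕ) : CyclicAlgebra n ξ a b := x n ξ a b ^ i * y n ξ a b ^ j

theorem span_mon_nat :
    Submodule.span F (Set.range fun q : ℕ × ℕ => mon n ξ a b q.1 q.2) = ⊤ := by
  set S := Submodule.span F (Set.range fun q : ℕ × ℕ => mon n ξ a b q.1 q.2) with hS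
  have hx : ∀ z ∈ S, x n ξ a b * z ∈ S := by
    intro z hz
    induction hz using Submodule.span_induction with
    | mem z hz =>
      obtain ⟨q, rfl⟩ := hz
      refine Submodule.subset_span ⟨(q.1 + 1, q.2), ?_⟩
      simp only [mon, pow_succ', mul_assoc]
    | zero => simp
    | add z w _ _ h1 h2 => rw [mul_add]; exact S.add_mem h1 h2
    | smul c z _ h => rw [mul_smul_comm]; exact S.smul_mem c h
  have hy : ∀ z ∈ S, y n ξ a b * z ∈ S := by
    intro z hz
    induction hz using Submodule.span_induction with
    | mem z hz =>
      obtain ⟨q, rfl⟩ := hz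
      have h := y_pow_mul_x_pow n ξ a b 1 q.1
      rw [pow_one] at h
      have : y n ξ a b * mon n ξ a b q.1 q.2
          = ξ ^ (1 * q.1) • mon n ξ a b q.1 (q.2 + 1) := by
        rw [mon, ← mul_assoc, h, smul_mul_assoc, mon, pow_succ', mul_assoc]
      show y n ξ a b * mon n ξ a b q.1 q.2 ∈ S
      rw [this]
      exact S.smul_mem _ (Submodule.subset_span ⟨(q.1, q.2 + 1), rfl⟩)
    | zero => simp
    | add z w _ _ h1 h2 => rw [mul_add]; exact S.add_mem h1 h2
    | smul c z _ h => rw [mul_smul_comm]; exact S.smul_mem c h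
  have key : ∀ f : FreeAlgebra F (Fin 2), ∀ z ∈ S,
      RingQuot.mkAlgHom F (Rel n ξ a b) f * z ∈ S := by
    intro f
    induction f using FreeAlgebra.induction with
    | grade0 r =>
      intro z hz
      rw [AlgHom.commutes, ← Algebra.smul_def]
      exact S.smul_mem r hz
    | grade1 i =>
      intro z hz
      fin_cases i
      · exact hx z hz
      · exact hy z hz
    | mul f g hf hg =>
      intro z hz
      rw [map_mul, mul_assoc]
      exact hf _ (hg _ hz)
    | add f g hf hg =>
      intro z hz
      rw [map_add, add_mul]
      exact S.add_mem (hf _ hz) (hg _ hz)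
  rw [eq_top_iff]
  intro z _
  obtain ⟨f, rfl⟩ := RingQuot.mkAlgHom_surjective F (Rel n ξ a b) z
  have h1 : (1 : CyclicAlgebra n ξ a b) ∈ S := Submodule.subset_span ⟨(0, 0), by simp [mon]⟩
  simpa using key f 1 h1

theorem span_mon [NeZero n] :
    Submodule.span F (Set.range fun q : Fin n × Fin n => mon n ξ a b q.1 q.2) = ⊤ := by
  rw [eq_top_iff, ← span_mon_nat, Submodule.span_le]
  rintro _ ⟨⟨i, j⟩, rfl⟩
  have hn : 0 < n := Nat.pos_of_ne_zero (NeZero.ne n)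
  have : mon n ξ a b i j = (a ^ (i / n) * b ^ (j / n)) • mon n ξ a b (i % n) (j % n) := by
    have h1 : x n ξ a b ^ i = a ^ (i / n) • x n ξ a b ^ (i % n) := by
      conv_lhs => rw [← Nat.div_add_mod i n, pow_add, pow_mul, x_pow_n, ← map_pow,
        ← Algebra.smul_def]
    have h2 : y n ξ a b ^ j = b ^ (j / n) • y n ξ a b ^ (j % n) := by
      conv_lhs => rw [← Nat.div_add_mod j n, pow_add, pow_mul, y_pow_n, ← map_pow,
        ← Algebra.smul_def]
    rw [mon, h1, h2, smul_mul_smul_comm, mon]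
  show mon n ξ a b i j ∈ _
  rw [this]
  exact Submodule.smul_mem _ _ (Submodule.subset_span
    ⟨(⟨i % n, Nat.mod_lt _ hn⟩, ⟨j % n, Nat.mod_lt _ hn⟩), rfl⟩)

theorem exists_coeff [NeZero n] (z : CyclicAlgebra n ξ a b) :
    ∃ c : Fin n × Fin n → F, z = ∑ q, c q • mon n ξ a b q.1 q.2 := by
  have hz : z ∈ Submodule.span F (Set.range fun q : Fin n × Fin n => mon n ξ a b q.1 q.2) := by
    rw [span_mon]; trivial
  obtain ⟨c, hc⟩ := (Submodule.mem_span_range_iff_exists_fun F).1 hz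
  exact ⟨c, hc.symm⟩

instance finiteDimensional [NeZero n] : FiniteDimensional F (CyclicAlgebra n ξ a b) :=
  Module.finite_def.2 (span_mon n ξ a b ▸ Submodule.fg_span (Set.finite_range _))

/-- The linear map `z ↦ x ^ (n - k) * y ^ l * z * (y ^ (n - l) * x ^ k)`. -/
noncomputable def conjMap (k l : ℕ) : CyclicAlgebra n ξ a b →ₗ[F] CyclicAlgebra n ξ a b :=
  LinearMap.mulLeft F (x n ξ a b ^ (n - k) * y n ξ a b ^ l) ∘ₗ
    LinearMap.mulRight F (y n ξ a b ^ (n - l) * x n ξ a b ^ k)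

theorem conjMap_apply (k l : ℕ) (z : CyclicAlgebra n ξ a b) :
    conjMap n ξ a b k l z = x n ξ a b ^ (n - k) * y n ξ a b ^ l *
      (z * (y n ξ a b ^ (n - l) * x n ξ a b ^ k)) := rfl

theorem conjMap_mon {k l : ℕ} (hk : k ≤ n) (hl : l ≤ n) (i j : ℕ) :
    conjMap n ξ a b k l (mon n ξ a b i j)
      = (ξ ^ (i * l) * ξ ^ (j * k) * (a * b)) • mon n ξ a b i j := by
  rw [conjMap_apply, mon]
  set X := x n ξ a b with hX
  set Y := y n ξ a b with hY
  have e1 : Y ^ l * X ^ i = ξ ^ (l * i) • (X ^ i * Y ^ l) := y_pow_mul_x_pow n ξ a b l i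
  have e2 : Y ^ j * X ^ k = ξ ^ (j * k) • (X ^ k * Y ^ j) := y_pow_mul_x_pow n ξ a b j k
  have e3 : Y ^ l * (Y ^ j * Y ^ (n - l)) = b • Y ^ j := by
    rw [← pow_add, ← pow_add, show l + (j + (n - l)) = n + j by omega, pow_add, hY, y_pow_n,
      ← Algebra.smul_def]
  have e4 : X ^ (n - k) * (X ^ i * X ^ k) = a • X ^ i := by
    rw [← pow_add, ← pow_add, show n - k + (i + k) = n + i by omega, pow_add, hX, x_pow_n,
      ← Algebra.smul_def]
  calc X ^ (n - k) * Y ^ l * (X ^ i * Y ^ j * (Y ^ (n - l) * X ^ k))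
      = X ^ (n - k) * (Y ^ l * X ^ i) * (Y ^ j * Y ^ (n - l)) * X ^ k := by
        simp only [mul_assoc]
    _ = ξ ^ (l * i) • (X ^ (n - k) * X ^ i * (Y ^ l * (Y ^ j * Y ^ (n - l))) * X ^ k) := by
        rw [e1]; simp only [mul_smul_comm, smul_mul_assoc, mul_assoc]
    _ = (ξ ^ (l * i) * b) • (X ^ (n - k) * X ^ i * (Y ^ j * X ^ k)) := by
        rw [e3]; simp only [mul_smul_comm, smul_mul_assoc, mul_assoc, smul_smul]
    _ = (ξ ^ (l * i) * b * ξ ^ (j * k)) • (X ^ (n - k) * (X ^ i * X ^ k) * Y ^ j) := by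
        rw [e2]; simp only [mul_smul_comm, mul_assoc, smul_smul]
    _ = (ξ ^ (i * l) * ξ ^ (j * k) * (a * b)) • (X ^ i * Y ^ j) := by
        rw [e4, smul_mul_assoc, smul_smul, mul_comm l i]; congr 1; ring

/-- A multiple of the projection onto the line of `mon i j`. -/
noncomputable def proj (i j : ℕ) : CyclicAlgebra n ξ a b →ₗ[F] CyclicAlgebra n ξ a b :=
  ∑ k ∈ Finset.range n, ∑ l ∈ Finset.range n,
    (ξ ^ ((n - i) * l) * ξ ^ ((n - j) * k)) • conjMap n ξ a b k l

theorem proj_apply (i j : ℕ) (z : CyclicAlgebra n ξ a b) :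
    proj n ξ a b i j z = ∑ k ∈ Finset.range n, ∑ l ∈ Finset.range n,
      (ξ ^ ((n - i) * l) * ξ ^ ((n - j) * k)) • conjMap n ξ a b k l z := by
  simp [proj, LinearMap.sum_apply]

theorem proj_mon (i₀ j₀ i j : ℕ) :
    proj n ξ a b i₀ j₀ (mon n ξ a b i j) =
      ((∑ l ∈ Finset.range n, ξ ^ ((n - i₀ + i) * l)) *
        (∑ k ∈ Finset.range n, ξ ^ ((n - j₀ + j) * k)) * (a * b)) • mon n ξ a b i j := by
  rw [proj_apply, mul_comm (∑ l ∈ Finset.range n, _), Finset.sum_mul_sum, Finset.sum_mul,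
    Finset.sum_smul]
  refine Finset.sum_congr rfl fun k hk => ?_
  rw [Finset.sum_mul, Finset.sum_smul]
  refine Finset.sum_congr rfl fun l hl => ?_
  rw [conjMap_mon _ _ _ _ (Finset.mem_range.1 hk).le (Finset.mem_range.1 hl).le, smul_smul]
  congr 1
  rw [add_mul, add_mul, pow_add, pow_add]
  ring

end facts

section primitive

variable {n : ℕ} {ξ : F}

theorem geom_sum_primitive (hξ : IsPrimitiveRoot ξ n) {i₀ i : ℕ} (h₀ : i₀ < n) (hi : i < n) :
    ∑ l ∈ Finset.range n, ξ ^ ((n - i₀ + i) * l) = if i = i₀ then (n : F) else 0 := by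
  simp only [pow_mul]
  split_ifs with h
  · subst h
    simp [Nat.sub_add_cancel h₀.le, hξ.pow_eq_one]
  · have hne : ξ ^ (n - i₀ + i) ≠ 1 := by
      intro h1
      have hd := (hξ.pow_eq_one_iff_dvd _).1 h1
      obtain ⟨c, hc⟩ := hd
      have hc1 : c = 1 := by
        rcases c with _ | _ | c
        · omega
        · rfl
        · exfalso
          have : n * (c + 1 + 1) = n * c + n + n := by ring
          have := Nat.zero_le (n * c)
          omega
      subst hc1
      omega
    have h2 : (ξ ^ (n - i₀ + i) - 1) * ∑ l ∈ Finset.range n, (ξ ^ (n - i₀ + i)) ^ l = 0 := by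
      rw [mul_geom_sum, ← pow_mul, mul_comm, pow_mul, hξ.pow_eq_one, one_pow, sub_self]
    exact (mul_eq_zero.1 h2).resolve_left (sub_ne_zero.2 hne)

theorem proj_sum (hξ : IsPrimitiveRoot ξ n) (a b : F) (c : Fin n × Fin n → F) (q₀ : Fin n × Fin n) :
    proj n ξ a b q₀.1 q₀.2 (∑ q, c q • mon n ξ a b q.1 q.2) =
      ((n : F) * n * (a * b)) • c q₀ • mon n ξ a b q₀.1 q₀.2 := by
  rw [map_sum, Finset.sum_eq_single q₀]
  · rw [map_smul, proj_mon, geom_sum_primitive hξ q₀.1.2 q₀.1.2,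
      geom_sum_primitive hξ q₀.2.2 q₀.2.2, if_pos rfl, if_pos rfl, smul_comm]
  · intro q _ hq
    rw [map_smul, proj_mon, geom_sum_primitive hξ q₀.1.2 q.1.2,
      geom_sum_primitive hξ q₀.2.2 q.2.2]
    have : ¬ ((q.1 : ℕ) = q₀.1 ∧ (q.2 : ℕ) = q₀.2) := fun h =>
      hq (Prod.ext (Fin.ext h.1) (Fin.ext h.2))
    by_cases h1 : (q.1 : ℕ) = q₀.1
    · rw [if_neg fun h2 => this ⟨h1, h2⟩]; simp
    · rw [if_neg h1]; simp
  · simp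

variable [NeZero n]

theorem mon_isUnit {a b : F} (ha : a ≠ 0) (hb : b ≠ 0) (i j : ℕ) : IsUnit (mon n ξ a b i j) := by
  refine IsUnit.mul (IsUnit.pow _ ?_) (IsUnit.pow _ ?_)
  · rw [← isUnit_pow_iff (NeZero.ne n), x_pow_n]
    exact (isUnit_iff_ne_zero.2 ha).map _
  · rw [← isUnit_pow_iff (NeZero.ne n), y_pow_n]
    exact (isUnit_iff_ne_zero.2 hb).map _

theorem nontrivial (hξ : IsPrimitiveRoot ξ n) (a b : F) : Nontrivial (CyclicAlgebra n ξ a b) := by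
  obtain ⟨s, hs⟩ := IsAlgClosed.exists_pow_nat_eq (algebraMap F (AlgebraicClosure F) a)
    (Nat.pos_of_ne_zero (NeZero.ne n))
  obtain ⟨t, ht⟩ := IsAlgClosed.exists_pow_nat_eq (algebraMap F (AlgebraicClosure F) b)
    (Nat.pos_of_ne_zero (NeZero.ne n))
  let V := ZMod n → AlgebraicClosure F
  let w : ZMod n → AlgebraicClosure F := fun i => s * algebraMap F _ (ξ ^ i.val)
  have hw : ∀ i, w i ^ n = algebraMap F _ a := fun i => by
    simp only [w]
    rw [mul_pow, hs, ← map_pow, ← pow_mul, mul_comm, mul_comm i.val, pow_mul, hξ.pow_eq_one,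
      one_pow, map_one, one_mul]
  have hw1 : ∀ i, w (i + 1) = algebraMap F _ ξ * w i := fun i => by
    simp only [w]
    have : ξ ^ (i + 1).val = ξ ^ (i.val + 1) := by
      rw [ZMod.val_add, ZMod.val_one_eq_one_mod, Nat.add_mod_mod,
        ← pow_eq_pow_mod _ hξ.pow_eq_one]
    rw [this, pow_succ, map_mul]; ring
  let X : Module.End F V :=
    { toFun := fun f i => w i * f i
      map_add' := fun f g => funext fun i => mul_add (w i) (f i) (g i)
      map_smul' := fun c f => funext fun i => mul_smul_comm c (w i) (f i) }
  let Y : Module.End F V :=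
    { toFun := fun f i => t * f (i + 1)
      map_add' := fun f g => funext fun i => mul_add t (f (i + 1)) (g (i + 1))
      map_smul' := fun c f => funext fun i => mul_smul_comm c t (f (i + 1)) }
  have hX : ∀ k f i, (X ^ k) f i = w i ^ k * f i := by
    intro k
    induction k with
    | zero => simp
    | succ k ih =>
      intro f i
      rw [pow_succ', Module.End.mul_apply]
      show w i * (X ^ k) f i = _
      rw [ih]; ring
  have hY : ∀ (k : ℕ) f i, (Y ^ k) f i = t ^ k * f (i + k) := by
    intro k
    induction k with
    | zero => simp
    | succ k ih =>
      intro f i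
      rw [pow_succ', Module.End.mul_apply]
      show t * (Y ^ k) f (i + 1) = _
      rw [ih, pow_succ']; push_cast; rw [add_right_comm, ← add_assoc, mul_assoc]
  let φ : FreeAlgebra F (Fin 2) →ₐ[F] Module.End F V := FreeAlgebra.lift F ![X, Y]
  have hφ : ∀ ⦃u v⦄, Rel n ξ a b u v → φ u = φ v := by
    intro u v h
    cases h with
    | x_pow =>
      refine LinearMap.ext fun f => funext fun i => ?_
      simp only [φ, map_pow, FreeAlgebra.lift_ι_apply, AlgHom.commutes, Matrix.cons_val_zero]
      rw [hX, hw, Module.algebraMap_end_apply, Pi.smul_apply, Algebra.smul_def]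
    | y_pow =>
      refine LinearMap.ext fun f => funext fun i => ?_
      simp only [φ, map_pow, FreeAlgebra.lift_ι_apply, AlgHom.commutes, Matrix.cons_val_one,
        Matrix.cons_val_fin_one]
      rw [hY, ht, Module.algebraMap_end_apply, Pi.smul_apply, Algebra.smul_def]
      simp
    | comm =>
      refine LinearMap.ext fun f => funext fun i => ?_
      simp only [φ, map_mul, map_smul, FreeAlgebra.lift_ι_apply, Matrix.cons_val_zero,
        Matrix.cons_val_one, Matrix.cons_val_fin_one]
      show t * (w (i + 1) * f (i + 1)) = ξ • (w i * (t * f (i + 1)))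
      rw [hw1, Algebra.smul_def]; ring
  exact (RingQuot.liftAlgHom F ⟨φ, hφ⟩).toRingHom.domain_nontrivial

theorem isSimpleRing (hξ : IsPrimitiveRoot ξ n) {a b : F} (ha : a ≠ 0) (hb : b ≠ 0) :
    IsSimpleRing (CyclicAlgebra n ξ a b) := by
  have := nontrivial hξ a b
  have := hξ.neZero'
  refine ⟨⟨fun I => ?_⟩⟩
  by_cases hI : I = ⊤
  · exact Or.inr hI
  left
  rw [eq_bot_iff]
  intro z hz
  obtain ⟨c, rfl⟩ := exists_coeff n ξ a b z
  have hsmul : ∀ (r : F) (w : CyclicAlgebra n ξ a b), w ∈ I → r • w ∈ I := fun r w hw => by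
    rw [Algebra.smul_def]; exact I.mul_mem_left _ _ hw
  have hc : ∀ q, c q = 0 := by
    intro q
    by_contra hq
    have h1 : proj n ξ a b q.1 q.2 (∑ q, c q • mon n ξ a b q.1 q.2) ∈ I := by
      rw [proj_apply]
      refine sum_mem fun k _ => sum_mem fun l _ => hsmul _ _ ?_
      rw [conjMap_apply]
      exact I.mul_mem_left _ _ (I.mul_mem_right _ _ hz)
    rw [proj_sum hξ, smul_smul] at h1
    have hn : (n : F) ≠ 0 := NeZero.ne _
    obtain ⟨r, hr⟩ : IsUnit (((n : F) * n * (a * b) * c q) • mon n ξ a b q.1 q.2) := by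
      rw [Algebra.smul_def]
      exact ((isUnit_iff_ne_zero.2 (by simp [ha, hb, hq, hn])).map _).mul (mon_isUnit ha hb _ _)
    apply hI
    rw [← TwoSidedIdeal.one_mem_iff]
    rw [← hr] at h1
    simpa using I.mul_mem_left (↑r⁻¹) _ h1
  simp [hc]

theorem isCentral (hξ : IsPrimitiveRoot ξ n) {a b : F} (ha : a ≠ 0) (hb : b ≠ 0) :
    Algebra.IsCentral F (CyclicAlgebra n ξ a b) := by
  have := hξ.neZero'
  have hn : (n : F) ≠ 0 := NeZero.ne _
  refine ⟨fun z hz => ?_⟩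
  rw [Subalgebra.mem_center_iff] at hz
  obtain ⟨c, hc⟩ := exists_coeff n ξ a b z
  let q₀ : Fin n × Fin n := (0, 0)
  have h1 : proj n ξ a b q₀.1 q₀.2 z = ((n : F) * n * (a * b)) • z := by
    have h2 : ∀ w, w * z = z * w := hz
    have h3 : proj n ξ a b q₀.1 q₀.2 z = z * proj n ξ a b q₀.1 q₀.2 1 := by
      rw [proj_apply, proj_apply, Finset.mul_sum]
      refine Finset.sum_congr rfl fun k _ => ?_
      rw [Finset.mul_sum]
      refine Finset.sum_congr rfl fun l _ => ?_
      rw [mul_smul_comm, conjMap_apply, conjMap_apply, ← mul_assoc, h2, one_mul, mul_assoc]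
    have h4 : (1 : CyclicAlgebra n ξ a b) = mon n ξ a b q₀.1 q₀.2 := by simp [mon, q₀]
    rw [h3, h4, proj_mon, geom_sum_primitive hξ q₀.1.2 q₀.1.2, if_pos rfl, ← h4, mul_smul_comm, mul_one]
  have h5 := proj_sum hξ a b c q₀
  rw [← hc, h1] at h5
  have h6 := smul_right_injective _ (show (n : F) * n * (a * b) ≠ 0 by simp [ha, hb, hn]) h5
  rw [Algebra.mem_bot]
  refine ⟨c q₀, ?_⟩
  rw [Algebra.algebraMap_eq_smul_one]
  simpa [mon, q₀] using h6.symm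

/-- The cyclic algebra `(a, b / F, ξ)`, `ξ` a primitive `n`-th root of unity and `a, b ≠ 0`, as a
finite-dimensional central simple algebra over `F`. -/
noncomputable def csa (hξ : IsPrimitiveRoot ξ n) (a b : Fˣ) : CSA.{u, u} F :=
  haveI := isSimpleRing hξ a.ne_zero b.ne_zero
  haveI := isCentral hξ a.ne_zero b.ne_zero
  { toAlgCat := AlgCat.of F (CyclicAlgebra n ξ (a : F) (b : F))
    isCentral := ‹_›
    isSimple := ‹_›
    fin_dim := finiteDimensional n ξ (a : F) (b : F) }

/-- The class of the cyclic algebra `(a, b / F, ξ)` in the Brauer group of `F`. -/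
noncomputable def brauerClass (hξ : IsPrimitiveRoot ξ n) (a b : Fˣ) : BrauerGroup.{u, u} F :=
  Quotient.mk (Brauer.CSA_Setoid F) (csa hξ a b)

end primitive

end CyclicAlgebra

variable (F) in
/-- `F` as a central simple algebra over itself. -/
noncomputable def baseCSA : CSA.{u, u} F where
  toAlgCat := AlgCat.of F F
  isCentral := inferInstanceAs (Algebra.IsCentral F F)
  isSimple := inferInstanceAs (IsSimpleRing F)
  fin_dim := inferInstanceAs (FiniteDimensional F F)

variable (F) in
/-- The trivial (identity) class of the Brauer group of `F`. -/
noncomputable def trivialBrauerClass : BrauerGroup.{u, u} F :=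
  Quotient.mk (Brauer.CSA_Setoid F) (baseCSA F)

end CyclicAlgebra

/-! ## Power classes as a Galois module -/

section PowerClasses

/-- The subgroup `E^{×p}` of `p`-th powers in the multiplicative group of a field `E`. -/
abbrev powSubgroup (p : ℕ) (E : Type v) [Field E] : Subgroup Eˣ :=
  (powMonoidHom p : Eˣ →* Eˣ).range

/-- `J = K^× / K^{×p}`, written additively. -/
def PowerClasses (p : ℕ) (K : Type v) [Field K] : Type v :=
  Additive (Kˣ ⧸ powSubgroup p K)

instance PowerClasses.addCommGroup (p : ℕ) (K : Type v) [Field K] :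
    AddCommGroup (PowerClasses p K) :=
  inferInstanceAs (AddCommGroup (Additive (Kˣ ⧸ powSubgroup p K)))

/-- The class `[γ]` in `J` of `γ ∈ K^×`. -/
def PowerClasses.mk (p : ℕ) {K : Type v} [Field K] (γ : Kˣ) : PowerClasses p K :=
  Additive.ofMul (QuotientGroup.mk γ)

theorem PowerClasses.mk_surjective (p : ℕ) (K : Type v) [Field K] :
    Function.Surjective (PowerClasses.mk p (K := K)) := fun z =>
  QuotientGroup.mk_surjective (Additive.toMul z)

theorem PowerClasses.nsmul_eq_zero (p : ℕ) (K : Type v) [Field K] (z : PowerClasses p K) :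
    p • z = 0 := by
  obtain ⟨w, rfl⟩ := PowerClasses.mk_surjective p K z
  exact (QuotientGroup.eq_one_iff (N := powSubgroup p K) (w ^ p)).2 ⟨w, rfl⟩

/-- The `𝔽_p`-vector space structure of `J`. -/
instance PowerClasses.module (p : ℕ) (K : Type v) [Field K] : Module (ZMod p) (PowerClasses p K) :=
  AddCommGroup.zmodModule (PowerClasses.nsmul_eq_zero p K)

variable (p : ℕ) (F : Type u) (K : Type v) [Field F] [Field K] [Algebra F K]

/-- The endomorphism `[γ] ↦ [g γ]` of `J` induced by `g ∈ Gal(K/F)`. -/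
def PowerClasses.galMap (g : K ≃ₐ[F] K) : PowerClasses p K →+ PowerClasses p K :=
  MonoidHom.toAdditive
    (QuotientGroup.map (powSubgroup p K) (powSubgroup p K) (Units.map (g : K →* K)) (by
      rintro _ ⟨w, rfl⟩
      exact ⟨Units.map (g : K →* K) w, by simp⟩))

/-- The representation of `G = Gal(K/F)` on the `𝔽_p`-vector space `J = K^× / K^{×p}`. -/
def powerRep : Representation (ZMod p) (K ≃ₐ[F] K) (PowerClasses p K) where
  toFun g := (PowerClasses.galMap p F K g).toZModLinearMap p
  map_one' := by
    refine LinearMap.ext fun z => ?_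
    obtain ⟨w, rfl⟩ := PowerClasses.mk_surjective p K z
    rfl
  map_mul' g h := by
    refine LinearMap.ext fun z => ?_
    obtain ⟨w, rfl⟩ := PowerClasses.mk_surjective p K z
    rfl

/-- `J = K^× / K^{×p}` as a module over the group ring `𝔽_p[G]`, `G = Gal(K/F)`. -/
abbrev GaloisPowerModule : Type v := (powerRep p F K).asModule

/-- The module `M` has a nonzero free direct summand. -/
def HasFreeSummand (R : Type u) [Ring R] (M : Type v) [AddCommGroup M] [Module R M] : Prop :=
  ∃ Y Z : Submodule R M, IsCompl Y Z ∧ Y ≠ ⊥ ∧ Module.Free R Y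

/-- `J` is `G`-invariant: `J^G = J`. -/
def IsGInvariant : Prop := (powerRep p F K).invariants = ⊤

/-- The norm subgroup `N(K^×)` of `F^×`. -/
noncomputable def normSubgroup : Subgroup Fˣ := (Units.map (Algebra.norm F : K →* F)).range

variable {F} in
/-- The class `[b]` of `b` in `F^× / F^{×p}`. -/
abbrev powClass (b : Fˣ) : Fˣ ⧸ powSubgroup p F := QuotientGroup.mk b

variable {p F} in
/-- `a` is `p`-rigid: `[b] ∈ ⟨[a]⟩` in `F^× / F^{×p}` whenever the cyclic algebra `(a, b / F, ξ)`
has trivial class in the Brauer group of `F`. -/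
def IsPRigid [NeZero p] {ξ : F} (hξ : IsPrimitiveRoot ξ p) (a : Fˣ) : Prop :=
  ∀ b : Fˣ, CyclicAlgebra.brauerClass hξ a b = trivialBrauerClass F →
    powClass p b ∈ Subgroup.zpowers (powClass p a)

end PowerClasses

/-!
Let `G = Gal(K/F) = ⟨σ⟩`, where `σ α = ξ α`, and let `ν = ∑ g` be the norm element of `𝔽_p[G]`.

The module theory reduces everything to `ν`. Since `𝔽_p[G]` is a local self-injective ring with socle
`𝔽_p ν`, a module has a nonzero free summand exactly when `ν` acts on it nontrivially
(`hasFreeSummand_iff`). On `J = K^×/K^{×p}` the element `ν` acts as the field norm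
(`normElement_smul_cls`), and by Kummer theory the kernel of `F^×/F^{×p} → J` is `⟨[a]⟩`
(`cls_unitsIncl_eq_zero_iff`). Hence `J` has no free summand exactly when the classes of norms lie in
`⟨[a]⟩`. A symbol algebra `(a, b)` is split exactly when `b` is a norm
(`brauerClass_eq_trivial_iff`): a splitting makes a `p`-dimensional space into a `K`-line on which
`y` acts as a `σ`-semilinear map `v ↦ c v`, whence `b = N(c)`. So the condition on norms is
`p`-rigidity of `a`. For `p = 2` it applies to `N(α) = -a` and gives `√-1 ∈ K`.

Freeness: in a free module the kernel of `ν` dies under every `G`-invariant map, in particular under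
the norm `J → F^×/F^{×p}`. For odd `p` the class of `α` contradicts this, because `N(α) = a` is a
`p`-th power in `K` and not in `F`; for `p = 2` the same happens with `α δ` if `N(δ) = -1`. Moreover
in a free module every invariant is a norm, which for `p = 2` gives `F^× = N ∪ -N`. Conversely, for
`p = 2` a module with `ker ν = im ν` is free (`free_of_ker_normElement`), and Hilbert 90 verifies this
for `J` (`free_of_quadratic`).

Invariance: for `p = 2`, `ν = σ - 1`. For odd `p`, if `J` is invariant then `[ξ] = (σ - 1)[α] = 0`,
so `K` contains a primitive `p²`-th root of unity. Conversely, if `a` is rigid and `[ξ] = 0`, then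
Hilbert 90 gives `(σ - 1) J = (σ - 1)² J`, and `(σ - 1)^p = 0` forces `(σ - 1) J = 0`
(`isGInvariant_of_odd`).
-/

/-! ### Modules over the group ring -/

section GroupRing

variable {k : Type*} {G : Type*} [Field k] [Group G]

variable (k G) in
/-- The augmentation `k[G] → k`, `∑ c_g g ↦ ∑ c_g`. -/
noncomputable def augmentation : MonoidAlgebra k G →ₐ[k] k := MonoidAlgebra.lift k k G 1

@[simp]
theorem augmentation_single (g : G) (c : k) :
    augmentation k G (MonoidAlgebra.single g c) = c := by
  simp [augmentation]

variable {M : Type*} [AddCommGroup M] [Module (MonoidAlgebra k G) M]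

/-- A `G`-invariant linear map out of a `k[G]`-module sees the scalars through the augmentation. -/
theorem map_smul_of_invariant [Module k M] [IsScalarTower k (MonoidAlgebra k G) M]
    {A : Type*} [AddCommGroup A] [Module k A] (ψ : M →ₗ[k] A)
    (hψ : ∀ (g : G) (m : M), ψ (MonoidAlgebra.of k G g • m) = ψ m)
    (r : MonoidAlgebra k G) (m : M) : ψ (r • m) = augmentation k G r • ψ m := by
  induction r using MonoidAlgebra.induction_linear with
  | zero => simp
  | add x y hx hy => rw [add_smul, map_add, hx, hy, map_add, add_smul]
  | single g c =>
    rw [augmentation_single, ← mul_one c, ← smul_eq_mul, ← MonoidAlgebra.smul_single,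
      smul_assoc, map_smul, smul_eq_mul, mul_one]
    exact congrArg _ (hψ g m)

variable [Fintype G]

theorem augmentation_eq_sum (r : MonoidAlgebra k G) :
    augmentation k G r = ∑ g, r.coeff g := by
  classical
  induction r using MonoidAlgebra.induction_linear with
  | zero => simp
  | add x y hx hy => simp [hx, hy, Finset.sum_add_distrib]
  | single g c => simp [Finsupp.single_apply]

variable (k G) in
/-- The norm element `∑ g` of the group ring `k[G]`. -/
noncomputable def normElement : MonoidAlgebra k G := ∑ g : G, MonoidAlgebra.of k G g

theorem normElement_coeff (h : G) : (normElement k G).coeff h = 1 := by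
  classical
  simp [normElement, Finsupp.single_apply]

theorem normElement_ne_zero : normElement k G ≠ 0 := by
  intro h
  have := normElement_coeff (k := k) (1 : G)
  simp [h] at this

theorem normElement_mul (r : MonoidAlgebra k G) :
    normElement k G * r = augmentation k G r • normElement k G := by
  induction r using MonoidAlgebra.induction_linear with
  | zero => simp
  | add x y hx hy => rw [mul_add, hx, hy, map_add, add_smul]
  | single h c =>
    rw [augmentation_single, normElement, Finset.sum_mul, Finset.smul_sum]
    refine Fintype.sum_bijective (· * h) (Group.mulRight_bijective h) _ _ fun g => ?_
    simp [MonoidAlgebra.single_mul_single]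

/-- An element fixed by left multiplication by `G` has constant coefficients. -/
theorem eq_smul_normElement {r : MonoidAlgebra k G}
    (h : ∀ g, MonoidAlgebra.of k G g * r = r) : r = r.coeff 1 • normElement k G := by
  ext g
  have := congrArg (fun s : MonoidAlgebra k G => s.coeff g) (h g)
  simp only [MonoidAlgebra.of_apply, MonoidAlgebra.coeff_single_mul_apply, one_mul,
    inv_mul_cancel] at this
  rw [MonoidAlgebra.coeff_smul_apply, normElement_coeff, ← this]
  simp

/-- In a free `k[G]`-module the kernel of the norm element is killed by every `G`-invariant linear
map: it is spanned by the elements `g • m - m`. -/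
theorem map_eq_zero_of_normElement_smul_eq_zero [Module k M]
    [IsScalarTower k (MonoidAlgebra k G) M] [Module.Free (MonoidAlgebra k G) M]
    {A : Type*} [AddCommGroup A] [Module k A] (ψ : M →ₗ[k] A)
    (hψ : ∀ (g : G) (m : M), ψ (MonoidAlgebra.of k G g • m) = ψ m)
    {m : M} (hm : normElement k G • m = 0) : ψ m = 0 := by
  let b := Module.Free.chooseBasis (MonoidAlgebra k G) M
  have hr : ∀ i, augmentation k G (b.repr m i) = 0 := by
    intro i
    have h : normElement k G * b.repr m i = 0 := by
      have := congrArg (fun z => b.repr z i) hm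
      simpa using this
    rw [normElement_mul] at h
    exact (smul_eq_zero.1 h).resolve_right normElement_ne_zero
  rw [← b.linearCombination_repr m, Finsupp.linearCombination_apply, Finsupp.sum, map_sum]
  exact Finset.sum_eq_zero fun i _ => by rw [map_smul_of_invariant ψ hψ, hr, zero_smul]

/-- In a free `k[G]`-module every invariant is a norm. -/
theorem exists_normElement_smul_eq [Module.Free (MonoidAlgebra k G) M]
    {m : M} (hm : ∀ g, MonoidAlgebra.of k G g • m = m) : ∃ m', normElement k G • m' = m := by
  let b := Module.Free.chooseBasis (MonoidAlgebra k G) M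
  have hr : ∀ i, b.repr m i = (b.repr m i).coeff 1 • normElement k G := by
    intro i
    refine eq_smul_normElement fun g => ?_
    have := congrArg (fun z => b.repr z i) (hm g)
    simpa using this
  refine ⟨∑ i ∈ (b.repr m).support, algebraMap k (MonoidAlgebra k G) ((b.repr m i).coeff 1) • b i,
    ?_⟩
  conv_rhs => rw [← b.linearCombination_repr m, Finsupp.linearCombination_apply, Finsupp.sum]
  rw [Finset.smul_sum]
  refine Finset.sum_congr rfl fun i _ => ?_
  conv_rhs => rw [hr i]
  rw [smul_smul, ← Algebra.commutes, ← Algebra.smul_def]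

/-- The norm element acts nontrivially on a nonzero free module. -/
theorem exists_normElement_smul_ne_zero_of_free [Nontrivial M]
    [Module.Free (MonoidAlgebra k G) M] : ∃ m : M, normElement k G • m ≠ 0 := by
  let b := Module.Free.chooseBasis (MonoidAlgebra k G) M
  obtain ⟨i⟩ : Nonempty (Module.Free.ChooseBasisIndex (MonoidAlgebra k G) M) := b.index_nonempty
  refine ⟨b i, fun h => normElement_ne_zero (k := k) (G := G) ?_⟩
  have := congrArg (fun z => b.repr z i) h
  simpa using this

/-- The `k[G]`-linear map `M → k[G]`, `m ↦ ∑ φ (g⁻¹ m) g` attached to a linear functional `φ`. -/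
noncomputable def coinducedMap [Module k M] (φ : M →ₗ[k] k)
    [IsScalarTower k (MonoidAlgebra k G) M] : M →ₗ[MonoidAlgebra k G] MonoidAlgebra k G where
  toFun m := ∑ g : G, MonoidAlgebra.single g (φ (MonoidAlgebra.of k G g⁻¹ • m))
  map_add' m n := by
    simp only [smul_add, map_add, MonoidAlgebra.single_add, Finset.sum_add_distrib]
  map_smul' r m := by
    rw [RingHom.id_apply, smul_eq_mul]
    induction r using MonoidAlgebra.induction_linear with
    | zero => simp
    | add x y hx hy =>
      simp only [add_smul, smul_add, map_add, MonoidAlgebra.single_add, Finset.sum_add_distrib,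
        add_mul] at hx hy ⊢
      rw [hx, hy]
    | single h c =>
      rw [Finset.mul_sum]
      symm
      refine Fintype.sum_bijective (h * ·) (Group.mulLeft_bijective h) _ _ fun g => ?_
      have : MonoidAlgebra.of k G (h * g)⁻¹ • MonoidAlgebra.single h c • m
          = c • MonoidAlgebra.of k G g⁻¹ • m := by
        rw [smul_smul, ← smul_assoc]
        congr 1
        simp [MonoidAlgebra.single_mul_single]
      rw [this, φ.map_smul, MonoidAlgebra.single_mul_single, smul_eq_mul]

theorem augmentation_coinducedMap [Module k M] (φ : M →ₗ[k] k)
    [IsScalarTower k (MonoidAlgebra k G) M] (m : M) :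
    augmentation k G (coinducedMap (G := G) φ m) = φ (normElement k G • m) := by
  simp only [coinducedMap, LinearMap.coe_mk, AddHom.coe_mk, map_sum, augmentation_single,
    normElement, Finset.sum_smul]
  exact Fintype.sum_bijective (·⁻¹) (Equiv.inv G).bijective _ _ fun g => rfl

/-- A surjection onto the ring itself splits off a free summand. -/
theorem hasFreeSummand_of_surjective {R : Type u} [Ring R] [Nontrivial R] {M : Type v}
    [AddCommGroup M] [Module R M] (f : M →ₗ[R] R) (hf : Function.Surjective f) :
    HasFreeSummand R M := by
  obtain ⟨m, hm⟩ := hf 1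
  let s : R →ₗ[R] M := LinearMap.toSpanSingleton R M m
  have hs : ∀ r, f (s r) = r := fun r => by simp [s, hm]
  have hinj : Function.Injective s := Function.LeftInverse.injective hs
  refine ⟨LinearMap.range s, LinearMap.ker f, ?_, ?_, ?_⟩
  · rw [isCompl_iff, Submodule.disjoint_def, codisjoint_iff, eq_top_iff]
    constructor
    · rintro _ ⟨r, rfl⟩ h
      rw [LinearMap.mem_ker, hs] at h
      rw [h, map_zero]
    · intro z _
      refine Submodule.mem_sup.2 ⟨s (f z), ⟨_, rfl⟩, z - s (f z), ?_, by abel⟩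
      rw [LinearMap.mem_ker, map_sub, hs, sub_self]
  · intro h
    rw [LinearMap.range_eq_bot] at h
    have := hs 1
    simp [h] at this
  · exact Module.Free.of_equiv (LinearEquiv.ofInjective s hinj)

end GroupRing

section Modular

/-- Over the group ring of a commutative group of exponent `p` in characteristic `p`, the `p`-th
power of an element is the `p`-th power of its augmentation. -/
theorem pow_eq_algebraMap_augmentation {k G : Type*} [Field k] [CommGroup G] [Fintype G] (p : ℕ)
    [Fact p.Prime] [CharP k p] (hG : ∀ g : G, g ^ p = 1) (r : MonoidAlgebra k G) :
    r ^ p = algebraMap k _ (augmentation k G r ^ p) := by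
  have : CharP (MonoidAlgebra k G) p :=
    charP_of_injective_algebraMap (algebraMap k (MonoidAlgebra k G)).injective p
  induction r using MonoidAlgebra.induction_linear with
  | zero => simp [(Fact.out : p.Prime).ne_zero]
  | add x y hx hy => rw [add_pow_char, hx, hy, map_add, add_pow_char, map_add]
  | single g c => simp [MonoidAlgebra.single_pow, hG]

/-- For `G` commutative of exponent `p`, a `k[G]`-module in characteristic `p` has a nonzero free
direct summand exactly when the norm element does not annihilate it. An element `m` not killed by
the norm element maps to a unit of the local ring `k[G]` under a suitable `coinducedMap`. -/
theorem hasFreeSummand_iff {k : Type*} {G : Type*} [Field k] [Group G] [Fintype G] (p : ℕ)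
    [Fact p.Prime] [CharP k p] (hcomm : ∀ g h : G, g * h = h * g) (hG : ∀ g : G, g ^ p = 1)
    {M : Type*} [AddCommGroup M] [Module k M] [Module (MonoidAlgebra k G) M]
    [IsScalarTower k (MonoidAlgebra k G) M] :
    HasFreeSummand (MonoidAlgebra k G) M ↔ ∃ m : M, normElement k G • m ≠ 0 := by
  constructor
  · rintro ⟨Y, -, -, hY, hfree⟩
    have := Submodule.nontrivial_iff_ne_bot.2 hY
    obtain ⟨m, hm⟩ := exists_normElement_smul_ne_zero_of_free (k := k) (G := G) (M := Y)
    exact ⟨m, fun h => hm (Subtype.ext h)⟩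
  · rintro ⟨m, hm⟩
    obtain ⟨φ, hφ⟩ : ∃ φ : M →ₗ[k] k, φ (normElement k G • m) ≠ 0 := by
      by_contra! h
      exact hm ((Module.forall_dual_apply_eq_zero_iff k _).1 h)
    let f := coinducedMap (G := G) φ
    have hu : IsUnit (f m) := by
      let : CommGroup G := { (inferInstance : Group G) with mul_comm := hcomm }
      have hp := (Fact.out : p.Prime).ne_zero
      refine (isUnit_pow_iff (M := MonoidAlgebra k G) hp).1 ?_
      have h1 := pow_eq_algebraMap_augmentation p hG (f m)
      have h2 : IsUnit (algebraMap k (MonoidAlgebra k G) (augmentation k G (f m) ^ p)) := by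
        refine IsUnit.map _ (isUnit_iff_ne_zero.2 (pow_ne_zero _ ?_))
        rw [augmentation_coinducedMap]
        exact hφ
      rw [← h1] at h2
      exact h2
    obtain ⟨w, hw⟩ := hu
    refine hasFreeSummand_of_surjective f fun r => ⟨(r * ↑w⁻¹) • m, ?_⟩
    rw [map_smul, ← hw, smul_eq_mul, mul_assoc, Units.inv_mul, mul_one]

/-- For `|G| = 2` in characteristic two, the augmentation ideal is spanned by the norm element. -/
theorem eq_smul_normElement_of_augmentation_eq_zero {k G : Type*} [Field k] [CharP k 2] [Group G]
    [Fintype G] (hG : Fintype.card G = 2) {r : MonoidAlgebra k G} (hr : augmentation k G r = 0) :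
    r = r.coeff 1 • normElement k G := by
  classical
  ext g
  rw [MonoidAlgebra.coeff_smul_apply, normElement_coeff, smul_eq_mul, mul_one]
  by_cases hg : g = 1
  · rw [hg]
  · have huniv : (Finset.univ : Finset G) = {1, g} := by
      symm
      rw [← Finset.card_eq_iff_eq_univ, hG, Finset.card_pair (Ne.symm hg)]
    rw [augmentation_eq_sum, huniv, Finset.sum_pair (Ne.symm hg)] at hr
    have : r.coeff g = -r.coeff 1 := by linear_combination hr
    rw [this, CharTwo.neg_eq]

/-- For `|G| = 2` in characteristic two, a module on which the kernel of the norm element is its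
image is free: preimages of a `k`-basis of the image form a `k[G]`-basis. -/
theorem free_of_ker_normElement {k G : Type*} [Field k] [CharP k 2] [Group G]
    [Fintype G] (hG : Fintype.card G = 2) {M : Type*} [AddCommGroup M] [Module k M]
    [Module (MonoidAlgebra k G) M] [IsScalarTower k (MonoidAlgebra k G) M]
    (hM : ∀ m : M, normElement k G • m = 0 → ∃ m', normElement k G • m' = m) :
    Module.Free (MonoidAlgebra k G) M := by
  set ν := normElement k G with hν
  have hνc : ∀ (c : k) (m : M), ν • c • m = c • ν • m := fun c m => by
    rw [← algebraMap_smul (MonoidAlgebra k G) c m, smul_smul, ← Algebra.commutes, ← smul_smul,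
      algebraMap_smul]
  let T : M →ₗ[k] M :=
    { toFun := fun m => ν • m
      map_add' := smul_add ν
      map_smul' := fun c m => hνc c m }
  let B := Module.Basis.ofVectorSpace k (LinearMap.range T)
  choose v hv using fun i => (B i).2
  have hv' : ∀ i, ν • v i = B i := hv
  have haug : ∀ (r : MonoidAlgebra k G) (m : M),
      ν • r • m = augmentation k G r • ν • m := fun r m => by
    rw [smul_smul, hν, normElement_mul, smul_assoc]
  have hspan : ∀ m : M, ∃ c : Module.Basis.ofVectorSpaceIndex k (LinearMap.range T) →₀ k,
      ν • m = c.sum fun i a => a • ν • v i := fun m => by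
    refine ⟨B.repr ⟨ν • m, LinearMap.mem_range.2 ⟨m, rfl⟩⟩, ?_⟩
    have := congrArg Subtype.val
      (B.linearCombination_repr ⟨ν • m, LinearMap.mem_range.2 ⟨m, rfl⟩⟩)
    rw [Finsupp.linearCombination_apply, Finsupp.sum, Submodule.coe_sum] at this
    refine this.symm.trans (Finset.sum_congr rfl fun i _ => ?_)
    beta_reduce
    rw [hv']
    rfl
  have hli : LinearIndependent (MonoidAlgebra k G) v := by
    rw [linearIndependent_iff']
    intro s r hsum
    have h1 : ∀ c : s → k, ∑ i : s, c i • ν • v i = 0 → ∀ i, c i = 0 := by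
      have := B.linearIndependent.comp ((↑) : s → _) Subtype.val_injective
      rw [Fintype.linearIndependent_iff] at this
      intro c hc
      refine this c (Subtype.ext ?_)
      rw [Submodule.coe_sum]
      simpa [hv'] using hc
    have h2 : ∀ i : s, augmentation k G (r i) = 0 := by
      refine h1 _ ?_
      rw [Finset.sum_coe_sort s fun i => augmentation k G (r i) • ν • v i]
      simp_rw [← haug]
      rw [← Finset.smul_sum, hsum, smul_zero]
    have h3 : ∀ i : s, (r i).coeff 1 = 0 := by
      refine h1 _ ?_
      rw [Finset.sum_coe_sort s fun i => (r i).coeff 1 • ν • v i, ← hsum]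
      refine Finset.sum_congr rfl fun i hi => ?_
      conv_rhs => rw [eq_smul_normElement_of_augmentation_eq_zero hG (h2 ⟨i, hi⟩)]
      rw [smul_assoc]
    intro i hi
    rw [eq_smul_normElement_of_augmentation_eq_zero hG (h2 ⟨i, hi⟩), h3 ⟨i, hi⟩, zero_smul]
  refine Module.Free.of_basis (Module.Basis.mk hli ?_)
  intro m _
  set S := Submodule.span (MonoidAlgebra k G) (Set.range v)
  have hS : ∀ (c : k) (r : MonoidAlgebra k G) i, c • r • v i ∈ S := fun c r i => by
    rw [← smul_assoc]
    exact S.smul_mem _ (Submodule.subset_span ⟨i, rfl⟩)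
  obtain ⟨c, hc⟩ := hspan m
  have h0 : ν • (m - c.sum fun i a => a • v i) = 0 := by
    rw [smul_sub, hc, sub_eq_zero, Finsupp.sum, Finsupp.sum, Finset.smul_sum]
    exact Finset.sum_congr rfl fun i _ => (hνc _ _).symm
  obtain ⟨m', hm'⟩ := hM _ h0
  obtain ⟨d, hd⟩ := hspan m'
  rw [hd, eq_sub_iff_add_eq] at hm'
  rw [← hm']
  refine S.add_mem (S.sum_mem fun i _ => hS _ _ _) (S.sum_mem fun i _ => ?_)
  simpa using hS (c i) 1 i

end Modular

/-! ### Cyclic extensions: Hilbert 90 and Kummer theory -/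

section CyclicExtension

variable {F : Type u} {K : Type v} [Field F] [Field K] [Algebra F K]

/-- A Kummer extension `F(α)`, `α ^ p = a`, of prime degree is Galois of degree `p`, and its group
is generated by the automorphism `α ↦ ξ α`. -/
theorem exists_kummer_generator {p : ℕ} (hp : p.Prime) {ξ : F} (hξ : IsPrimitiveRoot ξ p) {a : F}
    (ha : ∀ b : F, b ^ p ≠ a) {α : K} (hα : α ^ p = algebraMap F K a)
    (hK : IntermediateField.adjoin F {α} = ⊤) :
    FiniteDimensional F K ∧ IsGalois F K ∧ Module.finrank F K = p ∧
      ∃ σ : K ≃ₐ[F] K, σ α = algebraMap F K ξ * α ∧ ∀ g, g ∈ Subgroup.zpowers σ := by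
  have : NeZero p := ⟨hp.ne_zero⟩
  have hirr := X_pow_sub_C_irreducible_of_prime hp ha
  have hξ' : (primitiveRoots p F).Nonempty := ⟨ξ, (mem_primitiveRoots hp.pos).2 hξ⟩
  have hint : IsIntegral F α :=
    ⟨Polynomial.X ^ p - Polynomial.C a, Polynomial.monic_X_pow_sub_C _ hp.ne_zero, by simp [hα]⟩
  have hfin : FiniteDimensional F K := by
    have h1 := IntermediateField.adjoin.finiteDimensional hint
    rw [hK] at h1
    exact Module.Finite.equiv (IntermediateField.topEquiv (F := F) (E := K)).toLinearEquiv
  have hmin : Polynomial.X ^ p - Polynomial.C a = minpoly F α :=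
    minpoly.eq_of_irreducible_of_monic hirr (by simp [hα])
      (Polynomial.monic_X_pow_sub_C _ hp.ne_zero)
  have hrank : Module.finrank F K = p := by
    rw [← IntermediateField.finrank_top', ← hK, IntermediateField.adjoin.finrank hint, ← hmin,
      Polynomial.natDegree_X_pow_sub_C]
  have hsplit : Polynomial.IsSplittingField F K (Polynomial.X ^ p - Polynomial.C a) := by
    have := isSplittingField_X_pow_sub_C_of_root_adjoin_eq_top (K := F) (L := K) (a := a) (α := α)
      (by rw [hrank]; exact hξ') (by rw [hrank]; exact hα) hK
    rwa [hrank] at this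
  refine ⟨hfin, isGalois_of_isSplittingField_X_pow_sub_C hξ' hirr K, hrank, ?_⟩
  let e := autEquivZmod hirr K hξ
  refine ⟨e.symm (Multiplicative.ofAdd ((1 : ℕ) : ZMod p)), ?_, fun g => ?_⟩
  · rw [autEquivZmod_symm_apply_natCast hirr K hα hξ 1, pow_one, Algebra.smul_def]
  · refine ⟨((e g).toAdd.val : ℤ), ?_⟩
    refine e.injective ?_
    simp only [zpow_natCast, map_pow, MulEquiv.apply_symm_apply]
    rw [← ofAdd_nsmul]
    simp

variable [FiniteDimensional F K] [IsGalois F K] {p : ℕ} (hrank : Module.finrank F K = p)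
  {σ : K ≃ₐ[F] K} (hσ : ∀ g, g ∈ Subgroup.zpowers σ)

include hrank hσ

theorem orderOf_generator_eq : orderOf σ = p := by
  rw [orderOf_eq_card_of_forall_mem_zpowers hσ, IsGalois.card_aut_eq_finrank, hrank]

theorem generator_pow_eq_one : σ ^ p = 1 := by
  rw [← orderOf_generator_eq hrank hσ, pow_orderOf_eq_one]

theorem algebraMap_norm_eq_prod_range (x : K) :
    algebraMap F K (Algebra.norm F x) = ∏ i ∈ Finset.range p, (σ ^ i) x := by
  have ho := orderOf_generator_eq hrank hσ
  rw [Algebra.norm_eq_prod_automorphisms]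
  symm
  refine Finset.prod_bij (fun i _ => σ ^ i) (fun _ _ => Finset.mem_univ _) ?_ ?_ fun _ _ => rfl
  · intro i hi j hj h
    rw [Finset.mem_range, ← ho] at hi hj
    exact pow_injOn_Iio_orderOf (Set.mem_Iio.2 hi) (Set.mem_Iio.2 hj) h
  · intro g _
    obtain ⟨i, rfl⟩ := mem_powers_iff_mem_zpowers.2 (hσ g)
    have hp : 0 < p := hrank ▸ Module.finrank_pos
    refine ⟨i % p, Finset.mem_range.2 (Nat.mod_lt _ hp), ?_⟩
    rw [← ho]
    exact pow_mod_orderOf σ i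

/-- Hilbert's Theorem 90 for a cyclic extension `K / F`, with `F` and `K` in arbitrary universes. -/
theorem exists_generator_div_eq_of_norm_eq_one {x : K} (hx : Algebra.norm F x = 1) :
    ∃ y : K, y ≠ 0 ∧ σ y = x * y := by
  let c : ℕ → K := fun i => ∏ j ∈ Finset.range i, (σ ^ j) x
  have hcp : c p = 1 := by
    exact (algebraMap_norm_eq_prod_range hrank hσ x).symm.trans (by rw [hx, map_one])
  have hcs : ∀ i, x * σ (c i) = c (i + 1) := fun i => by
    simp only [c, map_prod, Finset.prod_range_succ', pow_zero, AlgEquiv.one_apply]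
    rw [mul_comm]
    simp only [pow_succ', AlgEquiv.mul_apply]
  have hp : 0 < p := hrank ▸ Module.finrank_pos
  -- Dedekind: the powers `σ ^ i`, `i < p`, are linearly independent over `K`.
  obtain ⟨z, hz⟩ : ∃ z, ∑ i ∈ Finset.range p, c i * (σ ^ i) z ≠ 0 := by
    by_contra! h
    have hli : LinearIndependent K (fun i : Fin p => ((σ ^ (i : ℕ) : K ≃ₐ[F] K) : K → K)) := by
      refine (linearIndependent_monoidHom K K).comp
        (fun i : Fin p => ((σ ^ (i : ℕ) : K ≃ₐ[F] K) : K →* K)) fun i j hij => Fin.ext ?_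
      refine pow_injOn_Iio_orderOf (x := σ) ?_ ?_ (AlgEquiv.ext fun w => DFunLike.congr_fun hij w)
      · simp [orderOf_generator_eq hrank hσ]
      · simp [orderOf_generator_eq hrank hσ]
    have := Fintype.linearIndependent_iff.1 hli (fun i => c i) (by
      funext w
      rw [Finset.sum_apply, Pi.zero_apply, ← h w, Finset.sum_range]
      rfl) ⟨0, hp⟩
    simp [c] at this
  set y := ∑ i ∈ Finset.range p, c i * (σ ^ i) z with hy
  have key : x * σ y = y := by
    have h1 : x * σ y = ∑ i ∈ Finset.range p, c (i + 1) * (σ ^ (i + 1)) z := by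
      rw [hy, map_sum, Finset.mul_sum]
      refine Finset.sum_congr rfl fun i _ => ?_
      rw [map_mul, ← mul_assoc, hcs, pow_succ', AlgEquiv.mul_apply]
    have h2 := Finset.sum_range_succ (fun i => c i * (σ ^ i) z) p
    rw [Finset.sum_range_succ', hcp, generator_pow_eq_one hrank hσ] at h2
    have h3 : c 0 = 1 := by simp [c]
    rw [h3, pow_zero] at h2
    rw [h1, hy]
    exact add_right_cancel h2
  have hσy : σ y ≠ 0 := (map_ne_zero_iff _ σ.injective).2 hz
  refine ⟨y⁻¹, inv_ne_zero hz, ?_⟩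
  rw [map_inv₀, eq_mul_inv_iff_mul_eq₀ hz, inv_mul_eq_iff_eq_mul₀ hσy, mul_comm, key]

omit hrank in
theorem mem_range_algebraMap_of_generator_fixed {x : K} (hx : σ x = x) :
    ∃ f : F, algebraMap F K f = x := by
  refine (IsGalois.mem_range_algebraMap_iff_fixed x).2 fun g => ?_
  have hle : Subgroup.zpowers σ ≤ MulAction.stabilizer (K ≃ₐ[F] K) x := by
    rw [Subgroup.zpowers_le]
    exact hx
  exact hle (hσ g)

omit hrank in
/-- Kummer theory: an element of `F` that becomes a `p`-th power in `F(α)`, `α ^ p = a`, is a power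
of `a` times a `p`-th power of `F`. -/
theorem exists_eq_pow_mul_pow_of_isPow [NeZero p] {ξ a : F} (hξ : IsPrimitiveRoot ξ p) {α : K}
    (hα : α ^ p = algebraMap F K a) (hα0 : α ≠ 0) (hσα : σ α = algebraMap F K ξ * α) {δ : K} {f : F}
    (hf : f ≠ 0) (hδ : δ ^ p = algebraMap F K f) : ∃ (i : ℕ) (g : F), f = a ^ i * g ^ p := by
  have hδ0 : δ ≠ 0 := by
    rintro rfl
    rw [zero_pow (NeZero.ne p)] at hδ
    exact hf ((map_eq_zero (algebraMap F K)).1 hδ.symm)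
  have hξK : IsPrimitiveRoot (algebraMap F K ξ) p := hξ.map_of_injective (algebraMap F K).injective
  have h1 : (σ δ / δ) ^ p = 1 := by
    rw [div_pow, ← map_pow, hδ, σ.commutes, div_self]
    rwa [← hδ, Ne, pow_eq_zero_iff (NeZero.ne p)]
  obtain ⟨j, -, hj⟩ := hξK.eq_pow_of_pow_eq_one h1
  have h2 : σ (δ / α ^ j) = δ / α ^ j := by
    rw [map_div₀, map_pow, hσα, mul_pow, hj]
    have hσδ : σ δ ≠ 0 := (map_ne_zero_iff _ σ.injective).2 hδ0
    field_simp
  obtain ⟨g, hg⟩ := mem_range_algebraMap_of_generator_fixed hσ h2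
  refine ⟨j, g, (algebraMap F K).injective ?_⟩
  rw [map_mul, map_pow, map_pow, hg, ← hα, ← hδ, ← pow_mul, mul_comm p j, pow_mul, ← mul_pow,
    mul_div_cancel₀ _ (pow_ne_zero _ hα0)]

end CyclicExtension

/-! ### Splitting of cyclic algebras -/

section CyclicAlgebraSplitting

namespace CyclicAlgebra

variable {F : Type u} [Field F] {n : ℕ} [NeZero n] {ξ : F}

/-- The monomials `x ^ i * y ^ j`, `i, j < n`, span the cyclic algebra and are separated by the
projections `proj`, so its dimension is `n²`. -/
theorem finrank_eq (hξ : IsPrimitiveRoot ξ n) {a b : F} (ha : a ≠ 0) (hb : b ≠ 0) :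
    Module.finrank F (CyclicAlgebra n ξ a b) = n * n := by
  have := hξ.neZero'
  have hn : (n : F) ≠ 0 := NeZero.ne _
  have := nontrivial hξ a b
  have hli : LinearIndependent F fun q : Fin n × Fin n => mon n ξ a b q.1 q.2 := by
    rw [Fintype.linearIndependent_iff]
    intro c hc q
    have h := proj_sum hξ a b c q
    rw [hc, map_zero, smul_smul] at h
    have h1 := (smul_eq_zero.1 h.symm).resolve_right (mon_isUnit ha hb _ _).ne_zero
    exact (mul_eq_zero.1 h1).resolve_left (by simp [ha, hb, hn])
  have h := Module.finrank_eq_card_basis (Module.Basis.mk hli (span_mon n ξ a b).ge)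
  simpa using h

/-- The algebra homomorphism out of the cyclic algebra given by images of `x` and `y` that satisfy
the defining relations. -/
noncomputable def lift {a b : F} {B : Type*} [Ring B] [Algebra F B] (X Y : B)
    (hX : X ^ n = algebraMap F B a) (hY : Y ^ n = algebraMap F B b) (hYX : Y * X = ξ • (X * Y)) :
    CyclicAlgebra n ξ a b →ₐ[F] B :=
  RingQuot.liftAlgHom F ⟨FreeAlgebra.lift F ![X, Y], by
    intro u v h
    cases h with
    | x_pow => simp [hX]
    | y_pow => simp [hY]
    | comm => simp [hYX]⟩

end CyclicAlgebra

variable {F : Type u} [Field F]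

/-- If `Mₙ(A) ≃ Mₘ(F)` and `dim A = d²`, then `A` acts on an `F`-vector space of dimension `d`, the
image of the matrix unit `e₁₁` acting on `F ^ m`. -/
theorem exists_algHom_end_of_matrix_algEquiv {A : Type u} [Ring A] [Algebra F A]
    {d n m : ℕ} (hA : Module.finrank F A = d * d) (hn : n ≠ 0)
    (e : Matrix (Fin n) (Fin n) A ≃ₐ[F] Matrix (Fin m) (Fin m) F) :
    ∃ (V : Submodule F (Fin m → F)) (_ : A →ₐ[F] Module.End F V), Module.finrank F V = d := by
  have : NeZero n := ⟨hn⟩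
  have hm : m = n * d := by
    have h := e.toLinearEquiv.finrank_eq
    rw [Module.finrank_matrix, Module.finrank_matrix, hA] at h
    simp only [Fintype.card_fin, Module.finrank_self, mul_one] at h
    have h2 : (n * d) * (n * d) = m * m := by rw [← h]; ring
    exact (Nat.mul_self_inj.1 h2).symm
  let W := Fin m → F
  let f : Matrix (Fin n) (Fin n) A →ₐ[F] Module.End F W :=
    (Matrix.toLinAlgEquiv' (R := F) (n := Fin m)).toAlgHom.comp e.toAlgHom
  let E : Fin n → Fin n → Module.End F W := fun i j => f (Matrix.single i j 1)
  have hE : ∀ i j k w, E i j (E j k w) = E i k w := fun i j k w => by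
    have : E i j * E j k = E i k := by
      simp only [E, ← map_mul, Matrix.single_mul_single_same, mul_one]
    rw [← this]; rfl
  have hE0 : ∀ i j k l, j ≠ k → ∀ w, E i j (E k l w) = 0 := fun i j k l h w => by
    have : E i j * E k l = 0 := by
      simp only [E, ← map_mul, Matrix.single_mul_single_of_ne _ _ _ _ h, map_zero]
    have := LinearMap.congr_fun this w
    exact this
  have hE1 : ∀ w, ∑ i, E i i w = w := fun w => by
    have : ∑ i, E i i = 1 := by
      simp only [E, ← map_sum]
      rw [Matrix.sum_single_one, map_one]
    have := LinearMap.congr_fun this w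
    simpa using this
  let V : Submodule F W := LinearMap.range (E 0 0)
  have hV : ∀ v ∈ V, E 0 0 v = v := by
    rintro _ ⟨w, rfl⟩
    exact hE _ _ _ _
  let g : A →ₐ[F] Module.End F W := f.comp (Matrix.scalarAlgHom (Fin n) F)
  have hg : ∀ z, ∀ v ∈ V, g z v ∈ V := by
    rintro z _ ⟨w, rfl⟩
    refine ⟨g z w, ?_⟩
    have : E 0 0 * g z = g z * E 0 0 := by
      simp only [E, g, AlgHom.comp_apply, ← map_mul]
      congr 1
      exact ((Matrix.scalar_commute_iff).2 (by simp)).symm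
    exact LinearMap.congr_fun this w
  refine ⟨V, AlgHom.ofLinearMap
    { toFun := fun z => (g z).restrict (hg z)
      map_add' := fun z w => by ext v : 2; simp
      map_smul' := fun c z => by ext v : 2; simp }
    (by ext v : 2; simp) (fun z w => by ext v : 2; simp), ?_⟩
  let L : W →ₗ[F] (Fin n → V) := LinearMap.pi fun i =>
    (E 0 i).codRestrict V fun w => ⟨E 0 i w, hE _ _ _ _⟩
  have hL : Function.Bijective L := by
    refine ⟨fun w w' h => ?_, fun s => ⟨∑ i, E i 0 (s i), ?_⟩⟩
    · rw [← hE1 w, ← hE1 w']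
      refine Finset.sum_congr rfl fun i _ => ?_
      have h1 : E 0 i w = E 0 i w' := congrArg Subtype.val (congrFun h i)
      rw [← hE i 0 i, h1, hE]
    · funext i
      refine Subtype.ext ?_
      show E 0 i (∑ j, E j 0 (s j)) = s i
      rw [map_sum, Finset.sum_eq_single i (fun j _ hj => hE0 _ _ _ _ hj.symm _) (by simp), hE,
        hV _ (s i).2]
  have h := (LinearEquiv.ofBijective L hL).finrank_eq
  rw [Module.finrank_fin_fun, Module.finrank_pi_fintype] at h
  simp only [Finset.sum_const, Finset.card_univ, Fintype.card_fin, smul_eq_mul] at h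
  exact (Nat.eq_of_mul_eq_mul_left (Nat.pos_of_ne_zero hn) (hm.symm.trans h)).symm

variable {K : Type v} [Field K] [Algebra F K] [FiniteDimensional F K] [IsGalois F K] {p : ℕ}
  (hrank : Module.finrank F K = p) {σ : K ≃ₐ[F] K} (hσ : ∀ g, g ∈ Subgroup.zpowers σ)
  {ξ a : F} {α : K} (hα : α ^ p = algebraMap F K a) (hK : IntermediateField.adjoin F {α} = ⊤)
  (hσα : σ α = algebraMap F K ξ * α)

include hrank hσ hα hK hσα

/-- If operators `X, Y` on a `p`-dimensional space satisfy the relations of the cyclic algebra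
`(a, b)`, then `b` is a norm from `K = F(α)`, `α ^ p = a`: through `X` the space becomes a
`K`-line, on which `Y` is `σ`-semilinear, so that `Y v = c v` gives `b = N(c)`. -/
theorem exists_norm_eq_of_operators {V : Type*} [AddCommGroup V] [Module F V]
    (hV : Module.finrank F V = p) {b : F} (X Y : Module.End F V)
    (hX : X ^ p = algebraMap F _ a) (hY : Y ^ p = algebraMap F _ b) (hYX : Y * X = ξ • (X * Y)) :
    ∃ c : K, Algebra.norm F c = b := by
  have hp : 0 < p := hrank ▸ Module.finrank_pos
  have hint : IsIntegral F α := IsIntegral.of_finite F α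
  have hmin : minpoly F α = Polynomial.X ^ p - Polynomial.C a := by
    refine (Polynomial.eq_of_monic_of_dvd_of_natDegree_le (minpoly.monic hint)
      (Polynomial.monic_X_pow_sub_C a hp.ne') (minpoly.dvd F α (by simp [hα])) ?_).symm
    rw [Polynomial.natDegree_X_pow_sub_C, ← IntermediateField.adjoin.finrank hint, hK,
      IntermediateField.finrank_top', hrank]
  have hadj : Algebra.adjoin F {α} = ⊤ := by
    rw [← IntermediateField.adjoin_simple_toSubalgebra_of_isAlgebraic hint.isAlgebraic, hK,
      IntermediateField.top_toSubalgebra]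
  let pb : PowerBasis F K := PowerBasis.ofAdjoinEqTop hint hadj
  have hgen : pb.gen = α := PowerBasis.ofAdjoinEqTop_gen hint hadj
  let φ : K →ₐ[F] Module.End F V := pb.lift X (by
    rw [hgen, hmin]; simp [hX])
  have hφα : φ α = X := by
    rw [← hgen]; exact pb.lift_gen _ _
  have hsemi : ∀ k : K, Y * φ k = φ (σ k) * Y := by
    intro k
    have hk : k ∈ Algebra.adjoin F {α} := hadj ▸ trivial
    induction hk using Algebra.adjoin_induction with
    | mem k hk =>
      rw [Set.mem_singleton_iff.1 hk, hσα, map_mul, AlgHom.commutes, hφα, hYX, mul_assoc,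
        Algebra.smul_def]
    | algebraMap r =>
      rw [σ.commutes, AlgHom.commutes]
      exact (Algebra.commutes _ _).symm
    | add k l _ _ h1 h2 => rw [map_add, map_add, map_add, mul_add, add_mul, h1, h2]
    | mul k l _ _ h1 h2 =>
      rw [map_mul, map_mul, map_mul, ← mul_assoc, h1, mul_assoc, h2, mul_assoc]
  have : Nontrivial V := Module.nontrivial_of_finrank_pos (R := F) (by omega)
  have : Module.Finite F V := Module.finite_of_finrank_pos (by omega)
  obtain ⟨v, hv⟩ := exists_ne (0 : V)
  let ev : K →ₗ[F] V := (LinearMap.applyₗ v).comp φ.toLinearMap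
  have hev : ∀ k, ev k = φ k v := fun k => rfl
  have hinj : Function.Injective ev := by
    rw [← LinearMap.ker_eq_bot, LinearMap.ker_eq_bot']
    intro k hk
    by_contra hk0
    have h1 : φ k⁻¹ (φ k v) = v := by
      rw [← Module.End.mul_apply, ← map_mul, inv_mul_cancel₀ hk0, map_one, Module.End.one_apply]
    rw [hev] at hk
    rw [hk, map_zero] at h1
    exact hv h1.symm
  have hsurj : Function.Surjective ev :=
    (LinearMap.injective_iff_surjective_of_finrank_eq_finrank (hrank.trans hV.symm)).1 hinj
  obtain ⟨c, hc⟩ := hsurj (Y v)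
  rw [hev] at hc
  have hpow : ∀ i, (Y ^ i) v = φ (∏ j ∈ Finset.range i, (σ ^ j) c) v := by
    intro i
    induction i with
    | zero => simp
    | succ i ih =>
      rw [pow_succ', Module.End.mul_apply, ih, ← Module.End.mul_apply, hsemi,
        Module.End.mul_apply, ← hc, ← Module.End.mul_apply, ← map_mul, Finset.prod_range_succ',
        map_prod]
      simp only [pow_succ', AlgEquiv.mul_apply, pow_zero, AlgEquiv.one_apply]
  refine ⟨c, ?_⟩
  have h := hpow p
  rw [← algebraMap_norm_eq_prod_range hrank hσ, hY, AlgHom.commutes,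
    Module.algebraMap_end_apply, Module.algebraMap_end_apply] at h
  exact (smul_left_injective F hv h).symm

/-- The cyclic algebra `(a, b)` splits if and only if `b` is a norm from `F(α)`, `α ^ p = a`. -/
theorem brauerClass_eq_trivial_iff [NeZero p] (hξ : IsPrimitiveRoot ξ p) {a' : Fˣ}
    (ha' : (a' : F) = a) (b : Fˣ) :
    CyclicAlgebra.brauerClass hξ a' b = trivialBrauerClass F ↔ b ∈ normSubgroup F K := by
  subst ha'
  have hdim := CyclicAlgebra.finrank_eq hξ a'.ne_zero b.ne_zero
  constructor
  · intro h
    obtain ⟨n, m, hn, -, ⟨e⟩⟩ : IsBrauerEquivalent _ _ := Quotient.exact h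
    obtain ⟨V, f, hV⟩ := exists_algHom_end_of_matrix_algEquiv
      (A := CyclicAlgebra p ξ (a' : F) b) hdim hn e
    obtain ⟨c, hc⟩ := exists_norm_eq_of_operators hrank hσ hα hK hσα hV
      (f (CyclicAlgebra.x p ξ (a' : F) b)) (f (CyclicAlgebra.y p ξ (a' : F) b))
      (by rw [← map_pow, CyclicAlgebra.x_pow_n, AlgHom.commutes])
      (by rw [← map_pow, CyclicAlgebra.y_pow_n, AlgHom.commutes])
      (by rw [← map_mul, CyclicAlgebra.y_mul_x, map_smul, map_mul])
    have hc0 : c ≠ 0 := by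
      rintro rfl
      rw [Algebra.norm_zero] at hc
      exact b.ne_zero hc.symm
    exact ⟨Units.mk0 c hc0, Units.ext hc⟩
  · rintro ⟨c, hc⟩
    have hc' : Algebra.norm F (c : K) = b := congrArg Units.val hc
    -- The splitting `x ↦ α`, `y ↦ c σ` on `K`.
    let X : Module.End F K := Algebra.lmul F K α
    let Y : Module.End F K := Algebra.lmul F K (c : K) * σ.toLinearMap
    have hYpow : ∀ i z, (Y ^ i) z = (∏ j ∈ Finset.range i, (σ ^ j) (c : K)) * (σ ^ i) z := by
      intro i
      induction i with
      | zero => simp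
      | succ i ih =>
        intro z
        rw [pow_succ', Module.End.mul_apply, ih]
        show (c : K) * σ _ = _
        rw [map_mul, map_prod, Finset.prod_range_succ']
        simp only [pow_succ', AlgEquiv.mul_apply, pow_zero, AlgEquiv.one_apply]
        ring
    have hX : X ^ p = algebraMap F _ (a' : F) := by
      rw [← map_pow, hα, AlgHom.commutes]
    have hY : Y ^ p = algebraMap F _ (b : F) := by
      ext z
      rw [hYpow, ← algebraMap_norm_eq_prod_range hrank hσ, hc', generator_pow_eq_one hrank hσ,
        AlgEquiv.one_apply, Module.algebraMap_end_apply, Algebra.smul_def]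
    have hYX : Y * X = ξ • (X * Y) := by
      ext z
      show (c : K) * σ (α * z) = ξ • (α * ((c : K) * σ z))
      rw [map_mul, hσα, Algebra.smul_def]
      ring
    let f := CyclicAlgebra.lift (n := p) X Y hX hY hYX
    have := CyclicAlgebra.isSimpleRing hξ a'.ne_zero b.ne_zero
    have hinj : Function.Injective f := f.toRingHom.injective
    have hbij : Function.Bijective f := by
      refine ⟨hinj, (LinearMap.injective_iff_surjective_of_finrank_eq_finrank
        (f := f.toLinearMap) ?_).1 hinj⟩
      rw [hdim, Module.finrank_linearMap, hrank]
    let e : CyclicAlgebra p ξ (a' : F) b ≃ₐ[F] Matrix (Fin p) (Fin p) F :=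
      (AlgEquiv.ofBijective f hbij).trans
        (LinearMap.toMatrixAlgEquiv (Module.finBasisOfFinrankEq F K hrank))
    have hB : IsBrauerEquivalent (CyclicAlgebra.csa hξ a' b) (baseCSA F) :=
      ⟨1, p, one_ne_zero, NeZero.ne p,
        ⟨(e.mapMatrix (m := Fin 1)).trans ((Matrix.compAlgEquiv (Fin 1) (Fin p) F F).trans
          (Matrix.reindexAlgEquiv F F (Equiv.uniqueProd (Fin p) (Fin 1))))⟩⟩
    exact Quotient.sound hB

end CyclicAlgebraSplitting

/-! ### The norm element on power classes -/

section PowerClassModule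

theorem powClass_mem_zpowers_iff {F : Type u} [Field F] {p : ℕ} {a b : Fˣ} :
    powClass p b ∈ Subgroup.zpowers (powClass p a) ↔ ∃ (i : ℤ) (f : Fˣ), b = a ^ i * f ^ p := by
  rw [Subgroup.mem_zpowers_iff]
  refine exists_congr fun i => ?_
  rw [powClass, powClass, ← QuotientGroup.mk_zpow, QuotientGroup.eq]
  constructor
  · rintro ⟨f, hf⟩
    exact ⟨f, by rw [← powMonoidHom_apply, hf, mul_inv_cancel_left]⟩
  · rintro ⟨f, rfl⟩
    exact ⟨f, by simp⟩

variable (p : ℕ) {F : Type u} {K : Type v} [Field F] [Field K] [Algebra F K]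

theorem PowerClasses.mk_eq_zero_iff {γ : Kˣ} :
    PowerClasses.mk p γ = 0 ↔ ∃ δ : Kˣ, δ ^ p = γ :=
  QuotientGroup.eq_one_iff (N := powSubgroup p K) γ

variable (F K) in
/-- The norm `K^× → F^×` on units. -/
noncomputable def unitsNorm : Kˣ →* Fˣ := Units.map (Algebra.norm F : K →* F)

variable (F K) in
/-- The inclusion `F^× → K^×`. -/
noncomputable def unitsIncl : Fˣ →* Kˣ := Units.map (algebraMap F K : F →* K)

/-- The action of an automorphism on `K^×`. -/
noncomputable def unitsGal (g : K ≃ₐ[F] K) : Kˣ →* Kˣ := Units.map (g : K →* K)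

@[simp] theorem unitsNorm_val (γ : Kˣ) : (unitsNorm F K γ : F) = Algebra.norm F (γ : K) := rfl

@[simp] theorem unitsIncl_val (f : Fˣ) : (unitsIncl F K f : K) = algebraMap F K f := rfl

@[simp] theorem unitsGal_val (g : K ≃ₐ[F] K) (γ : Kˣ) : (unitsGal g γ : K) = g γ := rfl

theorem unitsGal_unitsIncl (g : K ≃ₐ[F] K) (f : Fˣ) :
    unitsGal g (unitsIncl F K f) = unitsIncl F K f := Units.ext (g.commutes _)

theorem unitsNorm_unitsGal (g : K ≃ₐ[F] K) (γ : Kˣ) :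
    unitsNorm F K (unitsGal g γ) = unitsNorm F K γ :=
  Units.ext (Algebra.norm_eq_of_algEquiv g (γ : K))

variable (F) in
/-- The quotient map `K^× → J`, as a homomorphism of additive groups. -/
noncomputable def galoisClass : Additive Kˣ →+ GaloisPowerModule p F K where
  toFun γ := (powerRep p F K).asModuleEquiv.symm (PowerClasses.mk p γ.toMul)
  map_zero' := rfl
  map_add' _ _ := rfl

/-- The class of `γ ∈ K^×` in the `𝔽_p[G]`-module `J`. -/
noncomputable abbrev cls (F : Type u) [Field F] [Algebra F K] (γ : Kˣ) : GaloisPowerModule p F K :=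
  galoisClass p F (Additive.ofMul γ)

theorem cls_mul (γ δ : Kˣ) : cls p F (γ * δ) = cls p F γ + cls p F δ := rfl

theorem cls_inv (γ : Kˣ) : cls p F γ⁻¹ = -cls p F γ := rfl

theorem cls_zpow (γ : Kˣ) (i : ℤ) : cls p F (γ ^ i) = i • cls p F γ := rfl

theorem cls_surjective (m : GaloisPowerModule p F K) : ∃ γ : Kˣ, cls p F γ = m :=
  PowerClasses.mk_surjective p K m

theorem cls_eq_zero_iff {γ : Kˣ} : cls p F γ = 0 ↔ ∃ δ : Kˣ, δ ^ p = γ :=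
  PowerClasses.mk_eq_zero_iff p

theorem cls_pow_self (γ : Kˣ) : cls p F (γ ^ p) = 0 := (cls_eq_zero_iff p).2 ⟨γ, rfl⟩

variable (F K) in
/-- The map `J → F^× / F^{×p}` induced by the norm. -/
noncomputable def normMap : GaloisPowerModule p F K →ₗ[ZMod p] PowerClasses p F :=
  (AddMonoidHom.toZModLinearMap p (MonoidHom.toAdditive
    (QuotientGroup.map (powSubgroup p K) (powSubgroup p F) (unitsNorm F K) (by
        rintro _ ⟨w, rfl⟩
        exact ⟨unitsNorm F K w, by simp⟩)) : PowerClasses p K →+ PowerClasses p F)).comp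
    (powerRep p F K).asModuleEquiv.toLinearMap

theorem normMap_cls (γ : Kˣ) :
    normMap p F K (cls p F γ) = PowerClasses.mk p (unitsNorm F K γ) := rfl

theorem of_smul_cls (g : K ≃ₐ[F] K) (γ : Kˣ) :
    MonoidAlgebra.of (ZMod p) _ g • cls p F γ = cls p F (unitsGal g γ) := by
  rw [MonoidAlgebra.of_apply]
  refine (Representation.single_smul _ _ _ _).trans ?_
  rw [one_smul]
  rfl

theorem normMap_of_smul (g : K ≃ₐ[F] K) (m : GaloisPowerModule p F K) :
    normMap p F K (MonoidAlgebra.of (ZMod p) _ g • m) = normMap p F K m := by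
  obtain ⟨γ, rfl⟩ := cls_surjective p m
  rw [of_smul_cls, normMap_cls, normMap_cls, unitsNorm_unitsGal]

theorem isGInvariant_iff : IsGInvariant p F K ↔
    ∀ (g : K ≃ₐ[F] K) (m : GaloisPowerModule p F K), MonoidAlgebra.of (ZMod p) _ g • m = m := by
  rw [IsGInvariant, eq_top_iff]
  constructor
  · intro h g m
    obtain ⟨γ, rfl⟩ := cls_surjective p m
    rw [of_smul_cls]
    exact h (Submodule.mem_top (x := PowerClasses.mk p γ)) g
  · intro h m _ g
    obtain ⟨γ, rfl⟩ := PowerClasses.mk_surjective p K m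
    have := h g (cls p F γ)
    rwa [of_smul_cls] at this

theorem nsmul_galoisPowerModule (m : GaloisPowerModule p F K) : p • m = 0 :=
  PowerClasses.nsmul_eq_zero p K m

variable [FiniteDimensional F K] [IsGalois F K]

/-- The norm element of `𝔽_p[G]` acts on `J` as the field norm. -/
theorem normElement_smul_cls [Fact p.Prime] (γ : Kˣ) :
    normElement (ZMod p) (K ≃ₐ[F] K) • cls p F γ = cls p F (unitsIncl F K (unitsNorm F K γ)) := by
  have : unitsIncl F K (unitsNorm F K γ) = ∏ g : K ≃ₐ[F] K, unitsGal g γ := by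
    ext
    rw [Units.coe_prod]
    exact Algebra.norm_eq_prod_automorphisms F (γ : K)
  rw [this, cls, cls, ofMul_prod, map_sum, normElement, Finset.sum_smul]
  exact Finset.sum_congr rfl fun g _ => of_smul_cls p g γ

variable {p} (hrank : Module.finrank F K = p) {σ : K ≃ₐ[F] K}
  (hσ : ∀ g, g ∈ Subgroup.zpowers σ)

include hrank in
theorem unitsNorm_unitsIncl (f : Fˣ) : unitsNorm F K (unitsIncl F K f) = f ^ p := by
  ext
  simp [Algebra.norm_algebraMap, hrank]

omit [FiniteDimensional F K] [IsGalois F K] in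
include hσ in
theorem of_smul_eq_of_generator {k : Type*} [Field k] {M : Type*} [AddCommGroup M]
    [Module (MonoidAlgebra k (K ≃ₐ[F] K)) M] {m : M} (h : MonoidAlgebra.of k _ σ • m = m)
    (g : K ≃ₐ[F] K) : MonoidAlgebra.of k _ g • m = m := by
  obtain ⟨i, rfl⟩ := hσ g
  let f : (K ≃ₐ[F] K) →* (MonoidAlgebra k (K ≃ₐ[F] K)) := MonoidAlgebra.of k _
  let u : (MonoidAlgebra k (K ≃ₐ[F] K))ˣ := f.toHomUnits σ
  have hu : u ∈ MulAction.stabilizer (MonoidAlgebra k (K ≃ₐ[F] K))ˣ m := h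
  have := zpow_mem hu i
  rw [← map_zpow] at this
  exact this

include hrank hσ

/-- `J` has no nonzero free direct summand exactly when every norm from `K` is a `p`-th power
in `K`. -/
theorem hasFreeSummand_galoisPowerModule_iff [Fact p.Prime] :
    HasFreeSummand (MonoidAlgebra (ZMod p) (K ≃ₐ[F] K)) (GaloisPowerModule p F K) ↔
      ∃ γ : Kˣ, cls p F (unitsIncl F K (unitsNorm F K γ)) ≠ 0 := by
  rw [hasFreeSummand_iff (k := ZMod p) p]
  · constructor
    · rintro ⟨m, hm⟩
      obtain ⟨γ, rfl⟩ := cls_surjective p m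
      exact ⟨γ, by rwa [← normElement_smul_cls]⟩
    · rintro ⟨γ, h⟩
      exact ⟨cls p F γ, by rwa [normElement_smul_cls]⟩
  · intro g h
    obtain ⟨i, rfl⟩ := hσ g
    obtain ⟨j, rfl⟩ := hσ h
    exact zpow_mul_comm σ i j
  · intro g
    rw [← hrank, ← IsGalois.card_aut_eq_finrank, pow_card_eq_one']

theorem unitsHilbert90 {γ : Kˣ} (h : unitsNorm F K γ = 1) :
    ∃ δ : Kˣ, γ = unitsGal σ δ * δ⁻¹ := by
  obtain ⟨y, hy, hγ⟩ := exists_generator_div_eq_of_norm_eq_one hrank hσ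
    (x := (γ : K)) (congrArg Units.val h)
  refine ⟨Units.mk0 y hy, ?_⟩
  rw [eq_mul_inv_iff_mul_eq]
  exact Units.ext hγ.symm

variable {ξ : F} (hξ : IsPrimitiveRoot ξ p) {a : Fˣ} {α : Kˣ} (hα : α ^ p = unitsIncl F K a)
  (hσα : σ (α : K) = algebraMap F K ξ * α)

include hξ hα hσα

omit hrank in
/-- The kernel of `F^× / F^{×p} → J` is generated by the class of `a`. -/
theorem cls_unitsIncl_eq_zero_iff [NeZero p] (b : Fˣ) :
    cls p F (unitsIncl F K b) = 0 ↔ powClass p b ∈ Subgroup.zpowers (powClass p a) := by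
  rw [cls_eq_zero_iff, powClass_mem_zpowers_iff]
  constructor
  · rintro ⟨δ, hδ⟩
    obtain ⟨i, g, h⟩ := exists_eq_pow_mul_pow_of_isPow hσ hξ
      (congrArg Units.val hα) α.ne_zero hσα b.ne_zero (congrArg Units.val hδ)
    have hg : g ≠ 0 := by
      rintro rfl
      rw [zero_pow (NeZero.ne p), mul_zero] at h
      exact b.ne_zero h
    refine ⟨i, Units.mk0 g hg, Units.ext ?_⟩
    rw [h]
    simp
  · rintro ⟨i, f, rfl⟩
    refine ⟨α ^ i * unitsIncl F K f, ?_⟩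
    rw [mul_pow, map_mul, map_zpow, map_pow, ← hα, ← zpow_natCast (α ^ i), ← zpow_natCast α,
      zpow_comm]

omit hα hξ hrank hσ [FiniteDimensional F K] [IsGalois F K] in
theorem generator_pow_root (i : ℕ) : (σ ^ i) (α : K) = algebraMap F K ξ ^ i * α := by
  induction i with
  | zero => simp
  | succ i ih =>
    rw [pow_succ', AlgEquiv.mul_apply, ih, map_mul, map_pow, σ.commutes, hσα]
    ring

theorem unitsNorm_root_of_odd (hp : Odd p) : unitsNorm F K α = a := by
  ext
  refine (algebraMap F K).injective ?_
  rw [unitsNorm_val, algebraMap_norm_eq_prod_range hrank hσ]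
  simp_rw [generator_pow_root hσα]
  obtain ⟨c, hc⟩ := hp
  have hsum : ∑ i ∈ Finset.range p, i = p * c := by
    have := Finset.sum_range_id_mul_two p
    rw [hc, Nat.add_sub_cancel] at this
    rw [hc]
    nlinarith
  rw [Finset.prod_mul_distrib, Finset.prod_pow_eq_pow_sum, hsum, pow_mul, ← map_pow,
    hξ.pow_eq_one, map_one, one_pow, one_mul, Finset.prod_const, Finset.card_range]
  exact congrArg Units.val hα

theorem unitsNorm_root_of_two (hp : p = 2) : unitsNorm F K α = -a := by
  subst hp
  ext
  refine (algebraMap F K).injective ?_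
  rw [unitsNorm_val, algebraMap_norm_eq_prod_range hrank hσ]
  have hα' := congrArg Units.val hα
  simp_rw [generator_pow_root hσα, hξ.eq_neg_one_of_two_right]
  simp only [Units.val_pow_eq_pow_val, unitsIncl_val] at hα'
  simp only [Finset.prod_range_succ, Finset.prod_range_zero, Units.val_neg, map_neg, ← hα', map_one]
  ring

theorem not_hasFreeSummand_iff_powClass [Fact p.Prime] :
    ¬ HasFreeSummand (MonoidAlgebra (ZMod p) (K ≃ₐ[F] K)) (GaloisPowerModule p F K) ↔
      ∀ b ∈ normSubgroup F K, powClass p b ∈ Subgroup.zpowers (powClass p a) := by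
  rw [hasFreeSummand_galoisPowerModule_iff hrank hσ]
  push Not
  constructor
  · rintro h _ ⟨γ, rfl⟩
    exact (cls_unitsIncl_eq_zero_iff hσ hξ hα hσα _).1 (h γ)
  · intro h γ
    exact (cls_unitsIncl_eq_zero_iff hσ hξ hα hσα _).2 (h _ ⟨γ, rfl⟩)

omit hrank hσ hξ hα hσα in
/-- If `J` is free, a norm from `K` that is a `p`-th power in `K` is a `p`-th power in `F`. -/
theorem unitsNorm_mem_of_free [Fact p.Prime]
    [Module.Free (MonoidAlgebra (ZMod p) (K ≃ₐ[F] K)) (GaloisPowerModule p F K)]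
    {γ : Kˣ} (h : cls p F (unitsIncl F K (unitsNorm F K γ)) = 0) :
    unitsNorm F K γ ∈ powSubgroup p F := by
  rw [← normElement_smul_cls] at h
  have := map_eq_zero_of_normElement_smul_eq_zero (normMap p F K) (normMap_of_smul p) h
  rw [normMap_cls] at this
  exact (PowerClasses.mk_eq_zero_iff p).1 this

end PowerClassModule

/-! ### Freeness and invariance of the module of power classes -/

section KummerModule

variable {p : ℕ} {F : Type u} {K : Type v} [Field F] [Field K] [Algebra F K]
  [FiniteDimensional F K] [IsGalois F K] (hrank : Module.finrank F K = p) {σ : K ≃ₐ[F] K}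
  (hσ : ∀ g, g ∈ Subgroup.zpowers σ)
  {ξ : F} (hξ : IsPrimitiveRoot ξ p) {a : Fˣ} {α : Kˣ} (hα : α ^ p = unitsIncl F K a)
  (hσα : σ (α : K) = algebraMap F K ξ * α)

include hrank hσ hξ hα hσα

/-- For odd `p` the module `J` is never free: `α` has norm `a`, a `p`-th power in `K` only. -/
theorem not_free_of_odd [Fact p.Prime] (ha : a ∉ powSubgroup p F) (hp : Odd p) :
    ¬ Module.Free (MonoidAlgebra (ZMod p) (K ≃ₐ[F] K)) (GaloisPowerModule p F K) := by
  intro _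
  have hN := unitsNorm_root_of_odd hrank hσ hξ hα hσα hp
  refine ha ?_
  rw [← hN]
  refine unitsNorm_mem_of_free ?_
  rw [hN, ← hα]
  exact cls_pow_self p α

omit hrank hσ hξ hα hσα [FiniteDimensional F K] [IsGalois F K] in
/-- In characteristic `p`, an element of order dividing `p` acts unipotently: if `(σ - 1) M` equals
`(σ - 1)² M`, then `σ` acts trivially. -/
theorem of_smul_eq_self_of_divisible [Fact p.Prime] (hσp : σ ^ p = 1) {M : Type*} [AddCommGroup M]
    [Module (MonoidAlgebra (ZMod p) (K ≃ₐ[F] K)) M]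
    (h : ∀ m : M, ∃ m' : M, (MonoidAlgebra.of (ZMod p) _ σ - 1) • m =
      (MonoidAlgebra.of (ZMod p) _ σ - 1) • (MonoidAlgebra.of (ZMod p) _ σ - 1) • m')
    (m : M) : MonoidAlgebra.of (ZMod p) _ σ • m = m := by
  set s := MonoidAlgebra.of (ZMod p) (K ≃ₐ[F] K) σ - 1 with hs
  have : CharP (MonoidAlgebra (ZMod p) (K ≃ₐ[F] K)) p :=
    charP_of_injective_algebraMap
      (algebraMap (ZMod p) (MonoidAlgebra (ZMod p) (K ≃ₐ[F] K))).injective p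
  have hsp : s ^ p = 0 := by
    rw [hs, sub_pow_char_of_commute p (Commute.one_right _), ← map_pow, hσp, map_one, one_pow,
      sub_self]
  have hpow : ∀ k : ℕ, ∀ m : M, ∃ m' : M, s • m = s ^ (k + 1) • m' := by
    intro k
    induction k with
    | zero => exact fun m => ⟨m, by rw [zero_add, pow_one]⟩
    | succ k ih =>
      intro m
      obtain ⟨m₁, h₁⟩ := ih m
      obtain ⟨m₂, h₂⟩ := h m₁
      exact ⟨m₂, by rw [h₁, pow_succ, mul_smul, h₂, ← mul_smul, ← mul_smul, pow_succ, pow_succ]⟩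
  obtain ⟨m', hm'⟩ := hpow p m
  rw [pow_succ, hsp, zero_mul, zero_smul, hs, sub_smul, one_smul, sub_eq_zero] at hm'
  exact hm'

omit hξ hα hσα in
/-- A `G`-invariant `J` has no nonzero free summand: the norm element acts as multiplication by
`p`. -/
theorem not_hasFreeSummand_of_isGInvariant [Fact p.Prime] (h : IsGInvariant p F K) :
    ¬ HasFreeSummand (MonoidAlgebra (ZMod p) (K ≃ₐ[F] K)) (GaloisPowerModule p F K) := by
  rw [hasFreeSummand_galoisPowerModule_iff hrank hσ]
  push Not
  intro γ
  rw [isGInvariant_iff] at h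
  rw [← normElement_smul_cls, normElement, Finset.sum_smul, Finset.sum_congr rfl fun g _ => h g _,
    Finset.sum_const, Finset.card_univ, ← Nat.card_eq_fintype_card, IsGalois.card_aut_eq_finrank,
    hrank]
  exact nsmul_galoisPowerModule p _

omit hrank hσ hξ hα [FiniteDimensional F K] [IsGalois F K] in
/-- The class of `σ α / α = ξ` is trivial when `J` is `G`-invariant. -/
theorem exists_pow_eq_root_of_unity_of_isGInvariant (h : IsGInvariant p F K) :
    ∃ ζ : K, ζ ^ p = algebraMap F K ξ := by
  have h1 := (isGInvariant_iff p).1 h σ (cls p F α)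
  rw [of_smul_cls, ← sub_eq_zero, sub_eq_add_neg, ← cls_inv, ← cls_mul, cls_eq_zero_iff] at h1
  obtain ⟨δ, hδ⟩ := h1
  refine ⟨δ, ?_⟩
  have := congrArg Units.val hδ
  simpa [hσα] using this

/-- For odd `p`, if all norms from `K` are `p`-th powers in `K` and `ξ` is one, then `J` is
`G`-invariant: by Hilbert 90 every `γ` is `α ^ i * f * σ δ / δ` with `f ∈ F`, and `σ - 1` kills the
classes of `α` and `f`, so that `(σ - 1) J = (σ - 1)² J`. -/
theorem isGInvariant_of_odd [Fact p.Prime] (hp : Odd p)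
    (hN : ∀ b ∈ normSubgroup F K, powClass p b ∈ Subgroup.zpowers (powClass p a))
    (hζ : ∃ ζ : K, ζ ^ p = algebraMap F K ξ) : IsGInvariant p F K := by
  have hp0 := (Fact.out : p.Prime).ne_zero
  rw [isGInvariant_iff]
  intro g m
  refine of_smul_eq_of_generator hσ ?_ g
  refine of_smul_eq_self_of_divisible (generator_pow_eq_one hrank hσ) (fun m => ?_) m
  obtain ⟨γ, rfl⟩ := cls_surjective p m
  obtain ⟨i, f, hf⟩ := powClass_mem_zpowers_iff.1 (hN (unitsNorm F K γ) ⟨γ, rfl⟩)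
  have h1 : unitsNorm F K (γ * (α ^ i * unitsIncl F K f)⁻¹) = 1 := by
    rw [map_mul, map_inv, map_mul, map_zpow, unitsNorm_root_of_odd hrank hσ hξ hα hσα hp,
      unitsNorm_unitsIncl hrank, hf, mul_inv_cancel]
  obtain ⟨δ, hδ⟩ := unitsHilbert90 hrank hσ h1
  refine ⟨cls p F δ, ?_⟩
  have hγ : γ = unitsGal σ δ * δ⁻¹ * (α ^ i * unitsIncl F K f) := by
    rw [← hδ, inv_mul_cancel_right]
  have hα0 : (MonoidAlgebra.of (ZMod p) _ σ - 1) • cls p F α = 0 := by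
    obtain ⟨ζ, hζ⟩ := hζ
    have hζ0 : ζ ≠ 0 := by
      rintro rfl
      rw [zero_pow hp0] at hζ
      exact hξ.ne_zero hp0 ((map_eq_zero (algebraMap F K)).1 hζ.symm)
    rw [sub_smul, one_smul, of_smul_cls, sub_eq_add_neg, ← cls_inv, ← cls_mul, cls_eq_zero_iff]
    refine ⟨Units.mk0 ζ hζ0, ?_⟩
    rw [eq_mul_inv_iff_mul_eq]
    ext
    simp [hζ, hσα]
  have hf0 : (MonoidAlgebra.of (ZMod p) _ σ - 1) • cls p F (unitsIncl F K f) = 0 := by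
    rw [sub_smul, one_smul, of_smul_cls, unitsGal_unitsIncl, sub_self]
  have hδ0 : (MonoidAlgebra.of (ZMod p) _ σ - 1) • cls p F δ = cls p F (unitsGal σ δ * δ⁻¹) := by
    rw [sub_smul, one_smul, of_smul_cls, cls_mul, cls_inv, sub_eq_add_neg]
  rw [hδ0, hγ, cls_mul, cls_mul _ (α ^ i), cls_zpow, smul_add, smul_add, hf0, add_zero,
    smul_comm, hα0, smul_zero, add_zero]

end KummerModule

section Quadratic

variable {F : Type u} {K : Type v} [Field F] [Field K] [Algebra F K]
  [FiniteDimensional F K] [IsGalois F K] (hrank : Module.finrank F K = 2) {σ : K ≃ₐ[F] K}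
  (hσ : ∀ g, g ∈ Subgroup.zpowers σ)
  {ξ : F} (hξ : IsPrimitiveRoot ξ 2) {a : Fˣ} {α : Kˣ} (hα : α ^ 2 = unitsIncl F K a)
  (hσα : σ (α : K) = algebraMap F K ξ * α)

include hrank hσ

theorem unitsIncl_unitsNorm_quadratic (γ : Kˣ) :
    unitsIncl F K (unitsNorm F K γ) = γ * unitsGal σ γ := by
  ext
  rw [unitsIncl_val, unitsNorm_val, algebraMap_norm_eq_prod_range hrank hσ]
  simp [Finset.prod_range_succ]

/-- For `p = 2` the norm element acts as `1 + σ = σ - 1`, so `J` without a free summand is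
`G`-invariant. -/
theorem isGInvariant_of_not_hasFreeSummand_quadratic
    (h : ¬ HasFreeSummand (MonoidAlgebra (ZMod 2) (K ≃ₐ[F] K)) (GaloisPowerModule 2 F K)) :
    IsGInvariant 2 F K := by
  rw [hasFreeSummand_galoisPowerModule_iff hrank hσ] at h
  push Not at h
  rw [isGInvariant_iff]
  intro g m
  refine of_smul_eq_of_generator hσ ?_ g
  obtain ⟨γ, rfl⟩ := cls_surjective 2 m
  have h1 := h γ
  rw [unitsIncl_unitsNorm_quadratic hrank hσ, cls_mul] at h1
  have h2 := nsmul_galoisPowerModule 2 (cls 2 F γ)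
  rw [two_nsmul] at h2
  rw [of_smul_cls]
  exact add_left_cancel (h1.trans h2.symm)

include hξ hα hσα

/-- Without a free summand the norm `-a = -α²` of `α` is a square in `K`. -/
theorem exists_sq_eq_neg_one_of_not_hasFreeSummand
    (h : ¬ HasFreeSummand (MonoidAlgebra (ZMod 2) (K ≃ₐ[F] K)) (GaloisPowerModule 2 F K)) :
    ∃ i : K, i ^ 2 = -1 := by
  rw [hasFreeSummand_galoisPowerModule_iff hrank hσ] at h
  push Not at h
  have h1 := h α
  rw [unitsNorm_root_of_two hrank hσ hξ hα hσα rfl, cls_eq_zero_iff] at h1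
  obtain ⟨δ, hδ⟩ := h1
  have hδ' : (δ : K) ^ 2 = -(α : K) ^ 2 := by
    have e1 := congrArg Units.val hδ
    have e2 := congrArg Units.val hα
    simp only [Units.val_pow_eq_pow_val, unitsIncl_val, Units.val_neg, map_neg] at e1 e2
    rw [e1, e2]
  refine ⟨δ / α, ?_⟩
  rw [div_pow, hδ', neg_div, div_self (pow_ne_zero _ α.ne_zero)]

/-- If `N(δ) = -1`, then `N(α δ) = a` is a square in `K` and not in `F`. -/
theorem neg_one_notMem_normSubgroup_of_free (ha : a ∉ powSubgroup 2 F)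
    [Module.Free (MonoidAlgebra (ZMod 2) (K ≃ₐ[F] K)) (GaloisPowerModule 2 F K)] :
    -1 ∉ normSubgroup F K := by
  rintro ⟨δ, hδ⟩
  have hN : unitsNorm F K (α * δ) = a := by
    rw [map_mul, unitsNorm_root_of_two hrank hσ hξ hα hσα rfl, show unitsNorm F K δ = -1 from hδ,
      neg_mul_neg, mul_one]
  refine ha ?_
  rw [← hN]
  refine unitsNorm_mem_of_free ?_
  rw [hN, ← hα]
  exact cls_pow_self 2 α

/-- In a free `J` the class of `f ∈ F^×` is invariant, hence a norm, so that `f ∈ N(κ) a ^ i F^{×2}`,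
and `-a` and squares are norms. -/
theorem mem_or_neg_mem_normSubgroup_of_free
    [Module.Free (MonoidAlgebra (ZMod 2) (K ≃ₐ[F] K)) (GaloisPowerModule 2 F K)] (f : Fˣ) :
    f ∈ normSubgroup F K ∨ -f ∈ normSubgroup F K := by
  obtain ⟨m, hm⟩ := exists_normElement_smul_eq (k := ZMod 2) (G := K ≃ₐ[F] K)
    (m := cls 2 F (unitsIncl F K f)) fun g => by rw [of_smul_cls, unitsGal_unitsIncl]
  obtain ⟨κ, rfl⟩ := cls_surjective 2 m
  rw [normElement_smul_cls, eq_comm, ← sub_eq_zero, sub_eq_add_neg, ← cls_inv, ← cls_mul,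
    ← map_inv, ← map_mul, cls_unitsIncl_eq_zero_iff hσ hξ hα hσα, powClass_mem_zpowers_iff] at hm
  obtain ⟨i, g, hg⟩ := hm
  rw [mul_inv_eq_iff_eq_mul] at hg
  have hsq : ∀ u : Fˣ, u ^ 2 ∈ normSubgroup F K := fun u =>
    ⟨unitsIncl F K u, unitsNorm_unitsIncl hrank u⟩
  have hκ : unitsNorm F K κ ∈ normSubgroup F K := ⟨κ, rfl⟩
  have ha : -a ∈ normSubgroup F K := ⟨α, unitsNorm_root_of_two hrank hσ hξ hα hσα rfl⟩
  rcases Int.even_or_odd' i with ⟨c, rfl | rfl⟩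
  · left
    have : f = (a ^ c * g) ^ 2 * unitsNorm F K κ := by
      rw [hg, mul_pow, zpow_mul', zpow_ofNat]
    rw [this]
    exact mul_mem (hsq _) hκ
  · right
    have : -f = -a * (a ^ c * g) ^ 2 * unitsNorm F K κ := by
      rw [hg, mul_pow, zpow_add, zpow_mul', zpow_ofNat, zpow_one, neg_mul, neg_mul]
      congr 2
      rw [mul_comm _ a, mul_assoc]
    rw [this]
    exact mul_mem (mul_mem ha (hsq _)) hκ

/-- A class killed by the norm element comes from `F` if `-1` is not a norm (Hilbert 90), and is
then a norm if `F^× = N ∪ -N`, since `-f = N(κ)` gives `N(α κ) = a f`, where `a` is a square in `K`. -/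
theorem free_of_quadratic (hneg : -1 ∉ normSubgroup F K)
    (hcov : ∀ f : Fˣ, f ∈ normSubgroup F K ∨ -f ∈ normSubgroup F K) :
    Module.Free (MonoidAlgebra (ZMod 2) (K ≃ₐ[F] K)) (GaloisPowerModule 2 F K) := by
  refine free_of_ker_normElement (k := ZMod 2) ?_ fun m hm => ?_
  · rw [← Nat.card_eq_fintype_card, IsGalois.card_aut_eq_finrank, hrank]
  obtain ⟨γ, rfl⟩ := cls_surjective 2 m
  rw [normElement_smul_cls, cls_eq_zero_iff, unitsIncl_unitsNorm_quadratic hrank hσ] at hm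
  obtain ⟨δ, hδ⟩ := hm
  have hη : (δ * γ⁻¹) ^ 2 * γ = unitsGal σ γ := by
    rw [mul_pow, hδ, inv_pow, ← div_eq_mul_inv, sq, mul_div_mul_left_eq_div, div_mul_cancel]
  have hη1 : unitsNorm F K (δ * γ⁻¹) = 1 := by
    have h1 : unitsNorm F K (δ * γ⁻¹) ^ 2 = 1 := by
      have := congrArg (unitsNorm F K) hη
      rwa [map_mul, unitsNorm_unitsGal, mul_eq_right, map_pow] at this
    have h2 : ((unitsNorm F K (δ * γ⁻¹) : Fˣ) : F) ^ 2 = 1 := congrArg Units.val h1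
    rcases eq_or_eq_neg_of_sq_eq_sq _ 1 (h2.trans (one_pow 2).symm) with h | h
    · exact Units.ext h
    · exact absurd ⟨_, Units.ext h⟩ hneg
  obtain ⟨β, hβ⟩ := unitsHilbert90 hrank hσ hη1
  rw [hβ] at hη
  have hfix : unitsGal σ (γ * (β ^ 2)⁻¹) = γ * (β ^ 2)⁻¹ := by
    rw [map_mul, map_inv, map_pow, ← hη, mul_pow, inv_pow]
    rw [mul_inv_eq_iff_eq_mul, mul_right_comm, mul_assoc, mul_assoc, mul_comm, mul_assoc]
  obtain ⟨f₀, hf₀⟩ := mem_range_algebraMap_of_generator_fixed hσ (congrArg Units.val hfix)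
  have hf₀0 : f₀ ≠ 0 := by
    rintro rfl
    rw [map_zero] at hf₀
    exact Units.ne_zero _ hf₀.symm
  let f : Fˣ := Units.mk0 f₀ hf₀0
  have hf : cls 2 F γ = cls 2 F (unitsIncl F K f) := by
    have : γ = unitsIncl F K f * β ^ 2 := by
      rw [← mul_inv_eq_iff_eq_mul]
      exact Units.ext hf₀.symm
    rw [this, cls_mul, cls_pow_self, add_zero]
  rw [hf]
  rcases hcov f with ⟨κ, hκ⟩ | ⟨κ, hκ⟩
  · refine ⟨cls 2 F κ, ?_⟩
    rw [normElement_smul_cls, show unitsNorm F K κ = f from hκ]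
  · refine ⟨cls 2 F (α * κ), ?_⟩
    rw [normElement_smul_cls, map_mul, unitsNorm_root_of_two hrank hσ hξ hα hσα rfl,
      show unitsNorm F K κ = -f from hκ, neg_mul_neg, map_mul, ← hα, cls_mul, cls_pow_self,
      zero_add]

end Quadratic

theorem corollary1 (p : ℕ) [Fact p.Prime] (F : Type u) (K : Type v) [Field F] [Field K]
    [Algebra F K] (ξ : F) (hξ : IsPrimitiveRoot ξ p)
    (a : Fˣ) (ha : a ∉ powSubgroup p F)
    (α : K) (hα : α ^ p = algebraMap F K a) (hK : IntermediateField.adjoin F {α} = ⊤) :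
    -- (1)
    (Module.Free (MonoidAlgebra (ZMod p) (K ≃ₐ[F] K)) (GaloisPowerModule p F K) ↔
      p = 2 ∧ -1 ∉ normSubgroup F K ∧
        (Set.univ : Set Fˣ) = (normSubgroup F K : Set Fˣ) ∪ -(normSubgroup F K : Set Fˣ)) ∧
    -- (2)
    (2 < p →
      (¬ HasFreeSummand (MonoidAlgebra (ZMod p) (K ≃ₐ[F] K)) (GaloisPowerModule p F K) ↔
        IsPRigid hξ a)) ∧
    (p = 2 →
      (¬ HasFreeSummand (MonoidAlgebra (ZMod p) (K ≃ₐ[F] K)) (GaloisPowerModule p F K) ↔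
        (normSubgroup F K).map (QuotientGroup.mk' (powSubgroup p F)) ≤
          Subgroup.zpowers (powClass p a)) ∧
      (¬ HasFreeSummand (MonoidAlgebra (ZMod p) (K ≃ₐ[F] K)) (GaloisPowerModule p F K) →
        ∃ i : K, i ^ 2 = -1)) ∧
    -- (3)
    (2 < p → (IsGInvariant p F K ↔ IsPRigid hξ a ∧ ∃ ζ : K, IsPrimitiveRoot ζ (p ^ 2))) ∧
    (p = 2 →
      (IsGInvariant p F K ↔
        ¬ HasFreeSummand (MonoidAlgebra (ZMod p) (K ≃ₐ[F] K)) (GaloisPowerModule p F K))) := by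
  have hp : p.Prime := Fact.out
  have hpow : ∀ b : F, b ^ p ≠ a := by
    intro b hb
    have hb0 : b ≠ 0 := by
      rintro rfl
      rw [zero_pow hp.ne_zero] at hb
      exact a.ne_zero hb.symm
    exact ha ⟨Units.mk0 b hb0, Units.ext hb⟩
  obtain ⟨_, _, hrank, σ, hσα, hσ⟩ := exists_kummer_generator hp hξ hpow hα hK
  have hα0 : α ≠ 0 := by
    rintro rfl
    rw [zero_pow hp.ne_zero] at hα
    exact a.ne_zero ((map_eq_zero (algebraMap F K)).1 hα.symm)
  obtain ⟨α, rfl⟩ : ∃ u : Kˣ, (u : K) = α := ⟨Units.mk0 α hα0, rfl⟩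
  have hαu : α ^ p = unitsIncl F K a := Units.ext hα
  have hsummand := not_hasFreeSummand_iff_powClass hrank hσ hξ hαu hσα
  have hrigid : IsPRigid hξ a ↔
      ∀ b ∈ normSubgroup F K, powClass p b ∈ Subgroup.zpowers (powClass p a) :=
    forall_congr' fun b => by rw [brauerClass_eq_trivial_iff hrank hσ hα hK hσα hξ rfl b]
  refine ⟨⟨fun hfree => ?_, ?_⟩, fun _ => hsummand.trans hrigid.symm, ?_,
    fun h2 => ⟨fun h => ?_, ?_⟩, ?_⟩
  · obtain rfl : p = 2 := hp.eq_two_or_odd'.resolve_right fun hodd =>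
      not_free_of_odd hrank hσ hξ hαu hσα ha hodd hfree
    refine ⟨rfl, neg_one_notMem_normSubgroup_of_free hrank hσ hξ hαu hσα ha, ?_⟩
    refine (Set.eq_univ_of_forall fun f => ?_).symm
    exact mem_or_neg_mem_normSubgroup_of_free hrank hσ hξ hαu hσα f
  · rintro ⟨rfl, hneg, hcov⟩
    refine free_of_quadratic hrank hσ hξ hαu hσα hneg fun f => ?_
    have hf : f ∈ (Set.univ : Set Fˣ) := trivial
    rw [hcov] at hf
    exact hf
  · rintro rfl
    refine ⟨hsummand.trans ?_, exists_sq_eq_neg_one_of_not_hasFreeSummand hrank hσ hξ hαu hσα⟩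
    rw [Subgroup.map_le_iff_le_comap]
    exact Iff.rfl
  · refine ⟨hrigid.2 (hsummand.1 (not_hasFreeSummand_of_isGInvariant hrank hσ h)), ?_⟩
    obtain ⟨ζ, hζ⟩ := exists_pow_eq_root_of_unity_of_isGInvariant hσα h
    have hξK := hξ.map_of_injective (algebraMap F K).injective
    refine ⟨ζ, ?_⟩
    rw [IsPrimitiveRoot.iff_orderOf]
    refine orderOf_eq_prime_pow ?_ ?_
    · rw [pow_one, hζ]
      exact hξK.ne_one hp.one_lt
    · rw [pow_succ, pow_one, pow_mul, hζ, hξK.pow_eq_one]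
  · rintro ⟨h, ζ, hζ⟩
    refine isGInvariant_of_odd hrank hσ hξ hαu hσα (hp.odd_of_ne_two h2.ne') (hrigid.1 h) ?_
    have hζp : IsPrimitiveRoot (ζ ^ p) p := hζ.pow (pow_pos hp.pos 2) (sq p)
    obtain ⟨i, -, hi⟩ := hζp.eq_pow_of_pow_eq_one
      (hξ.map_of_injective (algebraMap F K).injective).pow_eq_one
    exact ⟨ζ ^ i, by rw [← hi, ← pow_mul, ← pow_mul, mul_comm]⟩
  · rintro rfl
    exact ⟨not_hasFreeSummand_of_isGInvariant hrank hσ,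
      isGInvariant_of_not_hasFreeSummand_quadratic hrank hσ⟩
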